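/- Let $H^1=H^1(\mathbb R)$ be the Sobolev space of real-valued functions on $\mathbb R$ with norm $\|f\|_{H^1}=(\|f\|_{L^2}^2+\|f_x\|_{L^2}^2)^{1/2}$, and let $$(Hf)(x)=\frac1\pi\,\mathrm{P.V.}\!\int_{-\infty}^{\infty}\frac{f(y)}{x-y}\,dy$$ be the Hilbert transform. For $u_0,v_0\in H^1$ and $0<T<\infty$, a solution on $[0,T)$ of the system $$u_t=2uv,\qquad v_t=H(u^2),\qquad u(0)=u_0,\quad v(0)=v_0 \qquad (x\in\mathbb R)$$ means a pair $u,v\in C^1([0,T);H^1)$ with these initial values which satisfies, for every $t\in[0,T)$, both equations for almost every $x\in\mathbb R$. **Theorem.** Let $u_0,v_0\in H^1$, and suppose that $u_0$ is supported in the interval $(a,b)$ (that is, $u_0=0$ almost everywhere outside $(a,b)$). Put $\phi(x)=x-a$ and $$C=4\int_a^b\phi(x)\,u_0(x)^2\,v_0(x)\,dx,\qquad I_\infty=\int_0^\infty\frac{dy}{\sqrt{y^3+1}},\qquad T^*=\left(\frac{4C}{3\pi(b-a)^2}\right)^{-1/3}I_\infty .$$ If $C>0$, then the solution of the system with initial values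 $u_0,v_0$ develops a singularity in the $H^1$ norm no later than $T^*$. Precisely, there are a time $T$ with $0<T\le T^*$ and a solution $(u,v)$ on $[0,T)$ such that $$\lim_{t\to T^-}\big(\|u(t)\|_{H^1}+\|v(t)\|_{H^1}\big)=+\infty ,$$ and $(u,v)$ is the unique maximal solution: every solution $(u',v')$ on an interval $[0,T')$ with the same initial values satisfies $T'\le T$ and $(u',v')=(u,v)$ on $[0,T')$. -/

import Mathlib

open MeasureTheory Filter Set Topology
open scoped ContDiff

/-- `g` is the weak derivative of `f` on `ℝ`, for `f, g ∈ L²(ℝ)`: `∫ f φ' = - ∫ g φ` for every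
`φ ∈ C_c^∞(ℝ)`. -/
def HasWeakDeriv (f g : Lp ℝ 2 (volume : Measure ℝ)) : Prop :=
  ∀ φ : ℝ → ℝ, ContDiff ℝ ∞ φ → HasCompactSupport φ →
    ∫ x, f x * deriv φ x = - ∫ x, g x * φ x

/-- An `L²` function times a continuous compactly supported function is integrable. -/
theorem integrable_lp_mul_test (f : Lp ℝ 2 (volume : Measure ℝ)) {φ : ℝ → ℝ}
    (hφ : Continuous φ) (hc : HasCompactSupport φ) :
    Integrable (fun x => f x * φ x) :=
  (Lp.memLp f).integrable_mul (hφ.memLp_of_hasCompactSupport (p := 2) hc)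

/-- The Sobolev space `H¹(ℝ)` of real-valued functions, realised as the subspace
`{(f, f') : f ∈ L², f' ∈ L²}` of the Hilbert sum `L²(ℝ) ⊕ L²(ℝ)`, where `f'` is the weak derivative
of `f` (which is determined by `f`). -/
def h1Submodule :
    Submodule ℝ (WithLp 2 (Lp ℝ 2 (volume : Measure ℝ) × Lp ℝ 2 (volume : Measure ℝ))) where
  carrier := {p | HasWeakDeriv p.fst p.snd}
  zero_mem' := by
    intro φ _ _
    have h : ((0 : Lp ℝ 2 (volume : Measure ℝ)) : ℝ → ℝ) =ᵐ[volume] 0 := Lp.coeFn_zero ℝ 2 volume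
    have e : ∀ ψ : ℝ → ℝ, ∫ x, (0 : Lp ℝ 2 (volume : Measure ℝ)) x * ψ x = 0 := fun ψ =>
      integral_eq_zero_of_ae (by filter_upwards [h] with x hx; rw [hx]; simp)
    change ∫ x, (0 : Lp ℝ 2 (volume : Measure ℝ)) x * deriv φ x
      = - ∫ x, (0 : Lp ℝ 2 (volume : Measure ℝ)) x * φ x
    rw [e, e, neg_zero]
  add_mem' := by
    intro p q hp hq φ hφ hc
    have hφ' : Continuous (deriv φ) := hφ.continuous_deriv (by simp)
    have e1 : ∫ x, (p.fst + q.fst) x * deriv φ x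
        = (∫ x, p.fst x * deriv φ x) + ∫ x, q.fst x * deriv φ x := by
      rw [← integral_add (integrable_lp_mul_test _ hφ' hc.deriv)
        (integrable_lp_mul_test _ hφ' hc.deriv)]
      refine integral_congr_ae ?_
      filter_upwards [Lp.coeFn_add p.fst q.fst] with x hx
      rw [hx, Pi.add_apply, add_mul]
    have e2 : ∫ x, (p.snd + q.snd) x * φ x = (∫ x, p.snd x * φ x) + ∫ x, q.snd x * φ x := by
      rw [← integral_add (integrable_lp_mul_test _ hφ.continuous hc)
        (integrable_lp_mul_test _ hφ.continuous hc)]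
      refine integral_congr_ae ?_
      filter_upwards [Lp.coeFn_add p.snd q.snd] with x hx
      rw [hx, Pi.add_apply, add_mul]
    have hp' := hp φ hφ hc
    have hq' := hq φ hφ hc
    change ∫ x, (p.fst + q.fst) x * deriv φ x = - ∫ x, (p.snd + q.snd) x * φ x
    rw [e1, e2, hp', hq', neg_add]
  smul_mem' := by
    intro c p hp φ hφ hc
    have e1 : ∫ x, (c • p.fst) x * deriv φ x = c * ∫ x, p.fst x * deriv φ x := by
      rw [← integral_const_mul]
      refine integral_congr_ae ?_
      filter_upwards [Lp.coeFn_smul c p.fst] with x hx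
      simp [hx, mul_assoc]
    have e2 : ∫ x, (c • p.snd) x * φ x = c * ∫ x, p.snd x * φ x := by
      rw [← integral_const_mul]
      refine integral_congr_ae ?_
      filter_upwards [Lp.coeFn_smul c p.snd] with x hx
      simp [hx, mul_assoc]
    have hp' := hp φ hφ hc
    change ∫ x, (c • p.fst) x * deriv φ x = - ∫ x, (c • p.snd) x * φ x
    rw [e1, e2, hp', mul_neg]

/-- The Sobolev space `H¹(ℝ)`, with the norm `‖f‖ = (‖f‖²_{L²} + ‖f'‖²_{L²})^{1/2}`. -/
abbrev H1 : Type := ↥h1Submodule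

/-- The function underlying an element of `H¹(ℝ)` (well defined up to almost everywhere equality). -/
noncomputable def H1.fn (f : H1) : ℝ → ℝ := fun x => f.val.fst x

/-- The principal value defining the Hilbert transform of `f` at `x` exists and
`(H f)(x) = (1/π) P.V. ∫ f(y) / (x - y) dy = l`. -/
def HasHilbertTransformAt (f : ℝ → ℝ) (x l : ℝ) : Prop :=
  Tendsto (fun ε : ℝ => (1 / Real.pi) * ∫ y in {y : ℝ | ε < |x - y|}, f y / (x - y))
    (𝓝[>] 0) (𝓝 l)

/-- `(u, v)` is a solution in `C¹([0, T); H¹(ℝ))` of `u_t = 2 u v`, `v_t = H(u²)` with initial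
values `u₀, v₀`. The time derivatives are taken in `H¹(ℝ)` (one-sided at `t = 0`). -/
structure IsH1Solution (u₀ v₀ : H1) (T : ℝ) (u v : ℝ → H1) : Prop where
  pos : 0 < T
  initial_u : u 0 = u₀
  initial_v : v 0 = v₀
  contDiffOn_u : ContDiffOn ℝ 1 u (Ico 0 T)
  contDiffOn_v : ContDiffOn ℝ 1 v (Ico 0 T)
  eq_u : ∀ t ∈ Ico 0 T, ∀ᵐ x : ℝ,
    (derivWithin u (Ico 0 T) t).fn x = 2 * (u t).fn x * (v t).fn x
  eq_v : ∀ t ∈ Ico 0 T, ∀ᵐ x : ℝ,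
    HasHilbertTransformAt (fun y => (u t).fn y ^ 2) x ((derivWithin v (Ico 0 T) t).fn x)

/-!
The space `H¹(ℝ)` is a Banach algebra up to a constant, and the Hilbert transform maps it to itself
with a bound, so `(u, v) ↦ (2uv, H(u²))` is a locally Lipschitz vector field on `H¹ × H¹`. Hence
there is a unique maximal solution, and if its lifespan is finite then its norm tends to infinity.

To bound the lifespan, put `F(t) = ∫ (x - a) u² dx`. At each `x` the first equation is linear in
`u`, so `u(t)` remains supported in `(a, b)`. Then `F' = 4 ∫ (x - a) u² v`, with initial value `C`,
and `F'' = 4 ∫ (x - a) u² H(u²) + 16 ∫ (x - a) u² v²`. Symmetrising the principal value in `(x, y)`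
replaces `(x - a) / (x - y)` by `1 / 2`, so the first term equals `(2 / π) (∫ u²)²`, whence
`F'' ≥ k F²` with `k = 2 / (π (b - a)²)`. Multiplying by `F'` and integrating gives
`F'² ≥ C² + (2k / 3) (F - F(0))³`, and separating variables bounds the time of existence by `T*`.
-/

/-! ### Primitives and weak derivatives -/

theorem intervalIntegrable_of_locallyIntegrable {f : ℝ → ℝ} (hf : LocallyIntegrable f) (a b : ℝ) :
    IntervalIntegrable f volume a b :=
  (hf.integrableOn_isCompact isCompact_uIcc).intervalIntegrable

theorem exists_tsupport_subset_Ioo {φ : ℝ → ℝ} (hc : HasCompactSupport φ) :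
    ∃ R, tsupport φ ⊆ Ioo (-R) R := by
  obtain ⟨R, hR⟩ := hc.isCompact.isBounded.subset_ball 0
  exact ⟨R, by simpa [Real.ball_eq_Ioo] using hR⟩

theorem integrable_mul_of_hasCompactSupport {w φ : ℝ → ℝ} (hw : LocallyIntegrable w)
    (hφ : Continuous φ) (hc : HasCompactSupport φ) : Integrable (fun x => w x * φ x) := by
  simpa [mul_comm] using hw.integrable_smul_left_of_hasCompactSupport hφ hc

/-- `F` is a primitive of `g`. For locally integrable `g` this says that `F` is locally absolutely
continuous with derivative `g` almost everywhere. -/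
def IsPrimitive (F g : ℝ → ℝ) : Prop := ∀ x y, F y - F x = ∫ t in x..y, g t

namespace IsPrimitive

variable {F g : ℝ → ℝ}

theorem eq_add_integral (h : IsPrimitive F g) (a : ℝ) : F = fun x => F a + ∫ t in a..x, g t :=
  funext fun x => by rw [← h a x, add_sub_cancel]

theorem integral (hg : LocallyIntegrable g) (a : ℝ) : IsPrimitive (fun x => ∫ t in a..x, g t) g :=
  fun _ _ => intervalIntegral.integral_interval_sub_left
    (intervalIntegrable_of_locallyIntegrable hg _ _)
    (intervalIntegrable_of_locallyIntegrable hg _ _)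

theorem add_const (h : IsPrimitive F g) (c : ℝ) : IsPrimitive (fun x => F x + c) g :=
  fun x y => by rw [add_sub_add_right_eq_sub, h x y]

theorem absolutelyContinuousOnInterval (h : IsPrimitive F g) (hg : LocallyIntegrable g) (a b : ℝ) :
    AbsolutelyContinuousOnInterval F a b := by
  rw [h.eq_add_integral a]
  have h_const : AbsolutelyContinuousOnInterval (fun _ : ℝ => F a) a b :=
    contDiffOn_const.absolutelyContinuousOnInterval
  exact h_const.fun_add ((intervalIntegrable_of_locallyIntegrable hg a b
    ).absolutelyContinuousOnInterval_intervalIntegral left_mem_uIcc)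

theorem continuous (h : IsPrimitive F g) (hg : LocallyIntegrable g) : Continuous F := by
  rw [h.eq_add_integral 0]
  exact continuous_const.add
    (intervalIntegral.continuous_primitive (intervalIntegrable_of_locallyIntegrable hg) 0)

theorem ae_hasDerivAt (h : IsPrimitive F g) (hg : LocallyIntegrable g) :
    ∀ᵐ x, HasDerivAt F (g x) x := by
  rw [h.eq_add_integral 0]
  filter_upwards [LocallyIntegrable.ae_hasDerivAt_integral hg] with x hx
  exact (hx 0).const_add _

theorem mul {G k : ℝ → ℝ} (hF : IsPrimitive F g) (hg : LocallyIntegrable g)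
    (hG : IsPrimitive G k) (hk : LocallyIntegrable k) :
    IsPrimitive (fun x => F x * G x) (fun x => g x * G x + F x * k x) := by
  intro x y
  rw [← (hF.absolutelyContinuousOnInterval hg x y).integral_deriv_mul_eq_sub
    (hG.absolutelyContinuousOnInterval hk x y)]
  apply intervalIntegral.integral_congr_ae
  filter_upwards [hF.ae_hasDerivAt hg, hG.ae_hasDerivAt hk] with t hFt hGt _
  rw [hFt.deriv, hGt.deriv]

theorem integral_mul_deriv_eq_neg (h : IsPrimitive F g) (hg : LocallyIntegrable g) {φ : ℝ → ℝ}
    (hφ : ContDiff ℝ 1 φ) (hc : HasCompactSupport φ) :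
    ∫ x, F x * deriv φ x = -∫ x, g x * φ x := by
  obtain ⟨R, hR⟩ := exists_tsupport_subset_Ioo hc
  have hφR : φ R = 0 := image_eq_zero_of_notMem_tsupport fun h' => lt_irrefl _ (hR h').2
  have hφR' : φ (-R) = 0 := image_eq_zero_of_notMem_tsupport fun h' => lt_irrefl _ (hR h').1
  have h_left : ∫ x, F x * deriv φ x = ∫ x in (-R)..R, F x * deriv φ x := by
    rw [intervalIntegral.integral_eq_integral_of_support_subset]
    exact fun x hx => Ioo_subset_Ioc_self
      (hR (support_deriv_subset (𝕜 := ℝ) (right_ne_zero_of_mul hx)))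
  have h_right : ∫ x, g x * φ x = ∫ x in (-R)..R, deriv F x * φ x := by
    rw [← intervalIntegral.integral_eq_integral_of_support_subset (a := -R) (b := R)]
    · refine intervalIntegral.integral_congr_ae ?_
      filter_upwards [h.ae_hasDerivAt hg] with x hx _
      rw [hx.deriv]
    · exact fun x hx => Ioo_subset_Ioc_self (hR (subset_tsupport _ (right_ne_zero_of_mul hx)))
  rw [h_left, h_right, (h.absolutelyContinuousOnInterval hg _ _).integral_mul_deriv_eq_deriv_mul
    hφ.contDiffOn.absolutelyContinuousOnInterval, hφR, hφR']
  ring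

end IsPrimitive

theorem exists_deriv_eq_of_integral_eq_zero {ψ : ℝ → ℝ} (hψ : ContDiff ℝ ∞ ψ)
    (hc : HasCompactSupport ψ) (h0 : ∫ x, ψ x = 0) :
    ∃ φ : ℝ → ℝ, ContDiff ℝ ∞ φ ∧ HasCompactSupport φ ∧ deriv φ = ψ := by
  obtain ⟨R, hR⟩ := exists_tsupport_subset_Ioo hc
  have h_deriv : ∀ x, HasDerivAt (fun x => ∫ t in (-R)..x, ψ t) (ψ x) x :=
    fun x => (hψ.continuous.integral_hasStrictDerivAt (-R) x).hasDerivAt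
  have h_deriv_eq : deriv (fun x => ∫ t in (-R)..x, ψ t) = ψ := funext fun x => (h_deriv x).deriv
  refine ⟨fun x => ∫ t in (-R)..x, ψ t, ?_, ?_, h_deriv_eq⟩
  · rw [contDiff_infty_iff_deriv, h_deriv_eq]
    exact ⟨fun x => (h_deriv x).differentiableAt, hψ⟩
  refine .intro (isCompact_Icc (a := -R) (b := R)) fun x hx => ?_
  rw [mem_Icc, not_and_or, not_le, not_le] at hx
  rcases hx with hx | hx
  · refine intervalIntegral.integral_zero_ae (Eventually.of_forall fun t ht =>
      image_eq_zero_of_notMem_tsupport fun ht' => ?_)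
    rw [uIoc_of_ge hx.le] at ht
    exact ht.2.not_gt (hR ht').1
  · rw [intervalIntegral.integral_eq_integral_of_support_subset, h0]
    exact (subset_tsupport _).trans
      (hR.trans (Ioo_subset_Ioc_self.trans (Ioc_subset_Ioc_right hx.le)))

theorem ae_eq_const_of_integral_mul_deriv_eq_zero {w : ℝ → ℝ} (hw : LocallyIntegrable w)
    (h : ∀ φ : ℝ → ℝ, ContDiff ℝ ∞ φ → HasCompactSupport φ → ∫ x, w x * deriv φ x = 0) :
    ∃ c : ℝ, ∀ᵐ x, w x = c := by
  let bump : ContDiffBump (0 : ℝ) := ⟨1, 2, one_pos, one_lt_two⟩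
  let η : ℝ → ℝ := bump.normed volume
  have hη : ContDiff ℝ ∞ η := bump.contDiff_normed
  have hηc : HasCompactSupport η := bump.hasCompactSupport_normed
  refine ⟨∫ x, w x * η x, ae_eq_of_integral_contDiff_smul_eq hw (locallyIntegrable_const _)
    fun ψ hψ hψc => ?_⟩
  let c : ℝ := ∫ x, ψ x
  have h_mean : ∫ x, (ψ x - c * η x) = 0 := by
    rw [integral_sub (hψ.continuous.integrable_of_hasCompactSupport hψc)
      ((hη.continuous.integrable_of_hasCompactSupport hηc).const_mul c), integral_const_mul,
      bump.integral_normed, mul_one, sub_self]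
  obtain ⟨φ, hφ, hφc, hφψ⟩ := exists_deriv_eq_of_integral_eq_zero
    (hψ.sub (contDiff_const.mul hη)) (hψc.sub hηc.mul_left) h_mean
  have h_test := h φ hφ hφc
  simp only [hφψ, mul_sub, mul_left_comm _ c] at h_test
  rw [integral_sub (integrable_mul_of_hasCompactSupport hw hψ.continuous hψc)
    ((integrable_mul_of_hasCompactSupport hw hη.continuous hηc).const_mul c),
    integral_const_mul] at h_test
  simp only [smul_eq_mul, mul_comm (ψ _)]
  rw [integral_const_mul, mul_comm _ c]
  exact sub_eq_zero.1 h_test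

theorem H1.locallyIntegrable_deriv (p : H1) : LocallyIntegrable p.val.snd :=
  (Lp.memLp p.val.snd).locallyIntegrable one_le_two

theorem H1.exists_isPrimitive (p : H1) :
    ∃ F : ℝ → ℝ, F =ᵐ[volume] p.val.fst ∧ IsPrimitive F p.val.snd := by
  have hg := p.locallyIntegrable_deriv
  have hf : LocallyIntegrable p.val.fst := (Lp.memLp p.val.fst).locallyIntegrable one_le_two
  let G : ℝ → ℝ := fun x => ∫ t in (0 : ℝ)..x, p.val.snd t
  have hG : IsPrimitive G p.val.snd := .integral hg 0
  have hG' : LocallyIntegrable G := (hG.continuous hg).locallyIntegrable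
  obtain ⟨c, hc⟩ : ∃ c : ℝ, ∀ᵐ x, p.val.fst x - G x = c := by
    refine ae_eq_const_of_integral_mul_deriv_eq_zero (hf.sub hG') fun φ hφ hφc => ?_
    have hφ' : Continuous (deriv φ) := hφ.continuous_deriv (by simp)
    simp only [sub_mul]
    rw [integral_sub (integrable_mul_of_hasCompactSupport hf hφ' hφc.deriv)
      (integrable_mul_of_hasCompactSupport hG' hφ' hφc.deriv), p.2 φ hφ hφc,
      hG.integral_mul_deriv_eq_neg hg (hφ.of_le (by simp)) hφc, sub_self]
  refine ⟨fun x => G x + c, ?_, hG.add_const c⟩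
  filter_upwards [hc] with x hx
  rw [← hx, add_sub_cancel]

/-! ### The space `H¹(ℝ)` -/

/-- `F` is locally absolutely continuous with derivative `g`, and both are square integrable: `F` is
the continuous representative of an element of `H¹(ℝ)`. -/
structure IsH1Pair (F g : ℝ → ℝ) : Prop where
  memLp : MemLp F 2
  memLp_deriv : MemLp g 2
  isPrimitive : IsPrimitive F g

namespace IsH1Pair

variable {F g : ℝ → ℝ}

theorem locallyIntegrable_deriv (h : IsH1Pair F g) : LocallyIntegrable g :=
  h.memLp_deriv.locallyIntegrable one_le_two

theorem continuous (h : IsH1Pair F g) : Continuous F :=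
  h.isPrimitive.continuous h.locallyIntegrable_deriv

/-- The element of `H¹(ℝ)` whose continuous representative is `F`. -/
noncomputable def toH1 (h : IsH1Pair F g) : H1 :=
  ⟨WithLp.toLp 2 (h.memLp.toLp F, h.memLp_deriv.toLp g), fun φ hφ hc =>
    calc ∫ x, h.memLp.toLp F x * deriv φ x
      _ = ∫ x, F x * deriv φ x := integral_congr_ae (h.memLp.coeFn_toLp.mul .rfl)
      _ = -∫ x, g x * φ x :=
        h.isPrimitive.integral_mul_deriv_eq_neg h.locallyIntegrable_deriv (hφ.of_le (by simp)) hc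
      _ = -∫ x, h.memLp_deriv.toLp g x * φ x :=
        congrArg _ (integral_congr_ae (h.memLp_deriv.coeFn_toLp.symm.mul .rfl))⟩

theorem toH1_fn (h : IsH1Pair F g) : h.toH1.fn =ᵐ[volume] F := h.memLp.coeFn_toLp

end IsH1Pair

theorem norm_sq_eq_integral_sq (f : Lp ℝ 2 (volume : Measure ℝ)) : ‖f‖ ^ 2 = ∫ x, f x ^ 2 := by
  rw [← real_inner_self_eq_norm_sq, L2.inner_def]
  simp [pow_two]

theorem H1.norm_sq (p : H1) : ‖p‖ ^ 2 = (∫ x, p.fn x ^ 2) + ∫ x, p.val.snd x ^ 2 :=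
  (WithLp.prod_norm_sq_eq_of_L2 p.val).trans
    (congrArg₂ _ (norm_sq_eq_integral_sq _) (norm_sq_eq_integral_sq _))

theorem IsH1Pair.norm_toH1_sq {F g : ℝ → ℝ} (h : IsH1Pair F g) :
    ‖h.toH1‖ ^ 2 = (∫ x, F x ^ 2) + ∫ x, g x ^ 2 := by
  rw [H1.norm_sq]
  exact congrArg₂ _ (integral_congr_ae (h.memLp.coeFn_toLp.pow_const 2))
    (integral_congr_ae (h.memLp_deriv.coeFn_toLp.pow_const 2))

namespace H1

/-- The continuous representative of an element of `H¹(ℝ)`. -/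
noncomputable def rep (p : H1) : ℝ → ℝ := p.exists_isPrimitive.choose

theorem rep_ae_eq (p : H1) : p.rep =ᵐ[volume] p.fn := p.exists_isPrimitive.choose_spec.1

theorem isH1Pair (p : H1) : IsH1Pair p.rep p.val.snd where
  memLp := (memLp_congr_ae p.rep_ae_eq).2 (Lp.memLp p.val.fst)
  memLp_deriv := Lp.memLp p.val.snd
  isPrimitive := p.exists_isPrimitive.choose_spec.2

theorem continuous_rep (p : H1) : Continuous p.rep := p.isH1Pair.continuous

theorem rep_eq_of_ae_eq (p : H1) {F : ℝ → ℝ} (hF : Continuous F) (h : p.fn =ᵐ[volume] F) :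
    p.rep = F :=
  (p.continuous_rep.ae_eq_iff_eq volume hF).1 (p.rep_ae_eq.trans h)

theorem rep_injective : Function.Injective rep := fun p q h => by
  have h_fst : p.val.fst = q.val.fst := Lp.ext (p.rep_ae_eq.symm.trans (h ▸ q.rep_ae_eq))
  have h_snd : p.val.snd = q.val.snd := by
    refine Lp.ext ?_
    filter_upwards [p.isH1Pair.isPrimitive.ae_hasDerivAt p.locallyIntegrable_deriv,
      q.isH1Pair.isPrimitive.ae_hasDerivAt q.locallyIntegrable_deriv] with x hp hq
    exact hp.unique (h ▸ hq)
  exact Subtype.ext (WithLp.ofLp_injective 2 (Prod.ext h_fst h_snd))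

theorem rep_add (p q : H1) : (p + q).rep = p.rep + q.rep :=
  rep_eq_of_ae_eq _ (p.continuous_rep.add q.continuous_rep)
    ((Lp.coeFn_add p.val.fst q.val.fst).trans (p.rep_ae_eq.symm.add q.rep_ae_eq.symm))

theorem rep_smul (c : ℝ) (p : H1) : (c • p).rep = c • p.rep :=
  rep_eq_of_ae_eq _ (p.continuous_rep.const_smul c)
    ((Lp.coeFn_smul c p.val.fst).trans (p.rep_ae_eq.symm.const_smul c))

end H1

theorem IsH1Pair.rep_toH1 {F g : ℝ → ℝ} (h : IsH1Pair F g) : h.toH1.rep = F :=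
  h.toH1.rep_eq_of_ae_eq h.continuous h.toH1_fn

/-! ### Sobolev embedding -/

theorem integral_abs_le_sqrt_mul_sqrt {α : Type*} [MeasurableSpace α] {μ : Measure α}
    [IsFiniteMeasure μ] {f : α → ℝ} (hf : MemLp f 2 μ) :
    ∫ x, |f x| ∂μ ≤ √(μ.real univ) * √(∫ x, f x ^ 2 ∂μ) := by
  have h := integral_mul_le_Lp_mul_Lq_of_nonneg (μ := μ) Real.HolderConjugate.two_two
    (.of_forall fun _ => zero_le_one) (.of_forall fun x => abs_nonneg (f x)) (memLp_const (1 : ℝ))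
    (by rw [ENNReal.ofReal_ofNat]; exact hf.abs)
  simpa [Real.sqrt_eq_rpow] using h

theorem intervalIntegral_abs_le_sqrt_mul_sqrt {f : ℝ → ℝ} (hf : MemLp f 2) {a b : ℝ}
    (hab : a ≤ b) : ∫ t in a..b, |f t| ≤ √(b - a) * √(∫ x, f x ^ 2) := by
  rw [intervalIntegral.integral_of_le hab]
  refine (integral_abs_le_sqrt_mul_sqrt (hf.restrict _)).trans ?_
  rw [measureReal_restrict_apply_univ, Real.volume_real_Ioc_of_le hab]
  gcongr
  · exact .of_forall fun x => sq_nonneg (f x)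
  · exact hf.integrable_sq
  · exact Measure.restrict_le_self

namespace IsH1Pair

variable {F g : ℝ → ℝ}

theorem abs_sub_le (h : IsH1Pair F g) (x y : ℝ) :
    |F y - F x| ≤ √|y - x| * √(∫ t, g t ^ 2) := by
  wlog hxy : x ≤ y generalizing x y
  · rw [abs_sub_comm, abs_sub_comm y x]; exact this y x (not_le.1 hxy).le
  rw [h.isPrimitive, abs_of_nonneg (sub_nonneg.2 hxy)]
  exact (intervalIntegral.abs_integral_le_integral_abs hxy).trans
    (intervalIntegral_abs_le_sqrt_mul_sqrt h.memLp_deriv hxy)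

theorem abs_le (h : IsH1Pair F g) (x : ℝ) :
    |F x| ≤ √(∫ t, F t ^ 2) + √(∫ t, g t ^ 2) := by
  have hx : x ≤ x + 1 := by linarith
  have h_osc : ∀ t ∈ Icc x (x + 1), |F x| ≤ |F t| + √(∫ t, g t ^ 2) := by
    intro t ht
    have h_sqrt : √|x - t| ≤ 1 := by
      rw [Real.sqrt_le_one, abs_sub_comm, abs_of_nonneg (sub_nonneg.2 ht.1)]
      linarith [ht.2]
    linarith [h.abs_sub_le t x, abs_sub_abs_le_abs_sub (F x) (F t),
      mul_le_of_le_one_left (Real.sqrt_nonneg (∫ t, g t ^ 2)) h_sqrt]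
  -- average over `[x, x + 1]`
  calc |F x| = ∫ _ in x..(x + 1), |F x| := by simp
    _ ≤ ∫ t in x..(x + 1), (|F t| + √(∫ t, g t ^ 2)) :=
      intervalIntegral.integral_mono_on hx (by simp)
        ((h.continuous.abs.add continuous_const).intervalIntegrable _ _) h_osc
    _ = (∫ t in x..(x + 1), |F t|) + √(∫ t, g t ^ 2) := by
      rw [intervalIntegral.integral_add (h.continuous.abs.intervalIntegrable _ _) (by simp)]
      simp
    _ ≤ √(∫ t, F t ^ 2) + √(∫ t, g t ^ 2) := by
      simpa using intervalIntegral_abs_le_sqrt_mul_sqrt h.memLp hx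

end IsH1Pair

namespace H1

theorem integral_rep_sq_le (p : H1) : ∫ t, p.rep t ^ 2 ≤ ‖p‖ ^ 2 := by
  rw [p.norm_sq]
  exact (integral_congr_ae (p.rep_ae_eq.pow_const 2)).trans_le
    (le_add_of_nonneg_right (integral_nonneg fun x => sq_nonneg _))

theorem integral_deriv_sq_le (p : H1) : ∫ t, p.val.snd t ^ 2 ≤ ‖p‖ ^ 2 := by
  rw [p.norm_sq]
  exact le_add_of_nonneg_left (integral_nonneg fun x => sq_nonneg _)

theorem abs_rep_le (p : H1) (x : ℝ) : |p.rep x| ≤ 2 * ‖p‖ := by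
  linarith [p.isH1Pair.abs_le x, Real.sqrt_le_iff.2 ⟨norm_nonneg p, p.integral_rep_sq_le⟩,
    Real.sqrt_le_iff.2 ⟨norm_nonneg p, p.integral_deriv_sq_le⟩]

/-- Point evaluation of the continuous representative, as a continuous linear functional. -/
noncomputable def evalL (x : ℝ) : H1 →L[ℝ] ℝ :=
  LinearMap.mkContinuous
    { toFun := fun p => p.rep x
      map_add' := fun p q => congrFun (rep_add p q) x
      map_smul' := fun c p => congrFun (rep_smul c p) x } 2 fun p => p.abs_rep_le x

end H1

/-! ### Completeness and weak compactness -/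

theorem real_inner_toLp_eq_integral {α : Type*} [MeasurableSpace α] {μ : Measure α} {φ : α → ℝ}
    (hφ : MemLp φ 2 μ) (f : Lp ℝ 2 μ) : inner ℝ (hφ.toLp φ) f = ∫ x, f x * φ x ∂μ := by
  rw [L2.inner_def]
  refine integral_congr_ae ?_
  filter_upwards [hφ.coeFn_toLp] with x hx
  simp [hx]

theorem isClosed_h1Submodule : IsClosed (h1Submodule : Set
    (WithLp 2 (Lp ℝ 2 (volume : Measure ℝ) × Lp ℝ 2 (volume : Measure ℝ)))) := by
  have h_eq : (h1Submodule : Set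
      (WithLp 2 (Lp ℝ 2 (volume : Measure ℝ) × Lp ℝ 2 (volume : Measure ℝ)))) =
      ⋂ (φ : ℝ → ℝ) (_ : ContDiff ℝ ∞ φ) (_ : HasCompactSupport φ),
        {p | ∫ x, p.fst x * deriv φ x = -∫ x, p.snd x * φ x} := by
    ext p
    simp only [mem_iInter]
    rfl
  rw [h_eq]
  refine isClosed_iInter fun φ => isClosed_iInter fun hφ => isClosed_iInter fun hc => ?_
  have hφL : MemLp φ 2 := hφ.continuous.memLp_of_hasCompactSupport hc
  have hφL' : MemLp (deriv φ) 2 :=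
    (hφ.continuous_deriv (by simp)).memLp_of_hasCompactSupport hc.deriv
  simp only [← real_inner_toLp_eq_integral hφL, ← real_inner_toLp_eq_integral hφL']
  exact isClosed_eq (continuous_const.inner (WithLp.fstL 2 ℝ _ _).continuous)
    (continuous_const.inner (WithLp.sndL 2 ℝ _ _).continuous).neg

instance H1.instCompleteSpace : CompleteSpace H1 :=
  isClosed_h1Submodule.completeSpace_coe

theorem exists_norm_le_forall_eq_of_tendsto {𝕜 E ι : Type*} [RCLike 𝕜] [NormedAddCommGroup E]
    [InnerProductSpace 𝕜 E] [CompleteSpace E] {𝓕 : Filter ι} [𝓕.NeBot] {w : ι → E} {B : ℝ}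
    (hB : ∀ i, ‖w i‖ ≤ B) :
    ∃ p : E, ‖p‖ ≤ B ∧
      ∀ (f : StrongDual 𝕜 E) (c : 𝕜), Tendsto (fun i => f (w i)) 𝓕 (𝓝 c) → f p = c := by
  let D := InnerProductSpace.toDual 𝕜 E
  let 𝓤 : Ultrafilter ι := .of 𝓕
  -- Banach–Alaoglu
  obtain ⟨ξ, hξ, h_lim⟩ := (WeakDual.isCompact_closedBall (𝕜 := 𝕜) (E := E) 0 B
    ).ultrafilter_le_nhds' (𝓤.map fun i => StrongDual.toWeakDual (D (w i)))
    (Ultrafilter.mem_map.2 (univ_mem' fun i => (dist_zero_right (E := StrongDual 𝕜 E) _).trans_le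
      ((D.norm_map (w i)).trans_le (hB i))))
  let p : E := D.symm (WeakDual.toStrongDual ξ)
  refine ⟨p, ?_, fun f c h => ?_⟩
  · rw [LinearIsometryEquiv.norm_map]
    exact (dist_zero_right (E := StrongDual 𝕜 E) _).symm.trans_le hξ
  have h_repr : ∀ q : E, f q = starRingEnd 𝕜 (inner 𝕜 q (D.symm f)) := fun q => by
    rw [inner_conj_symm]; exact InnerProductSpace.toDual_symm_apply.symm
  have h_weak : Tendsto (fun i => inner 𝕜 (w i) (D.symm f)) 𝓤 (𝓝 (inner 𝕜 p (D.symm f))) := by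
    rw [show inner 𝕜 p (D.symm f) = ξ (D.symm f) from InnerProductSpace.toDual_symm_apply]
    exact ((WeakDual.eval_continuous (D.symm f)).tendsto ξ).comp h_lim
  refine tendsto_nhds_unique ?_ (h.mono_left (Ultrafilter.of_le 𝓕))
  simp only [h_repr]
  exact (RCLike.continuous_conj.tendsto _).comp h_weak

theorem H1.exists_rep_eq_of_tendsto {ι : Type*} {𝓕 : Filter ι} [𝓕.NeBot] {w : ι → H1} {B : ℝ}
    (hB : ∀ i, ‖w i‖ ≤ B) {F : ℝ → ℝ} (h : ∀ x, Tendsto (fun i => (w i).rep x) 𝓕 (𝓝 (F x))) :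
    ∃ p : H1, p.rep = F ∧ ‖p‖ ≤ B :=
  let ⟨p, hp, h_eval⟩ := exists_norm_le_forall_eq_of_tendsto (𝕜 := ℝ) hB
  ⟨p, funext fun x => h_eval (evalL x) (F x) (h x), hp⟩

/-! ### Products -/

/-- Integrable `H¹` functions with integrable derivative, such as products of two `H¹` functions.
For these the principal value defining the Hilbert transform converges at every point. -/
structure IsW1Pair (F g : ℝ → ℝ) : Prop extends IsH1Pair F g where
  integrable : Integrable F
  integrable_deriv : Integrable g

theorem memLp_mul_of_abs_le {F G : ℝ → ℝ} {c : ℝ} (hF : AEStronglyMeasurable F)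
    (hc : ∀ x, |F x| ≤ c) (hG : MemLp G 2) : MemLp (fun x => F x * G x) 2 :=
  hG.mul (memLp_top_of_bound hF c (.of_forall hc))

theorem integral_mul_sq_le {F G : ℝ → ℝ} {c : ℝ} (hc : ∀ x, |F x| ≤ c) (hG : MemLp G 2) :
    ∫ x, (F x * G x) ^ 2 ≤ c ^ 2 * ∫ x, G x ^ 2 := by
  rw [← integral_const_mul]
  refine integral_mono_of_nonneg (.of_forall fun x => sq_nonneg _)
    (hG.integrable_sq.const_mul _) (.of_forall fun x => ?_)
  dsimp only
  rw [mul_pow]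
  gcongr ?_ * _
  exact sq_le_sq' (neg_le_of_abs_le (hc x)) (le_of_abs_le (hc x))

theorem integral_add_sq_le {α : Type*} [MeasurableSpace α] {μ : Measure α} {f g : α → ℝ}
    (hf : MemLp f 2 μ) (hg : MemLp g 2 μ) :
    ∫ x, (f x + g x) ^ 2 ∂μ ≤ 2 * (∫ x, f x ^ 2 ∂μ) + 2 * ∫ x, g x ^ 2 ∂μ := by
  rw [← mul_add, ← integral_add hf.integrable_sq hg.integrable_sq, ← integral_const_mul]
  exact integral_mono (hf.add hg).integrable_sq
    ((hf.integrable_sq.add hg.integrable_sq).const_mul 2) fun x => add_sq_le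

theorem IsH1Pair.mul {F f G g : ℝ → ℝ} (hF : IsH1Pair F f) (hG : IsH1Pair G g) :
    IsW1Pair (fun x => F x * G x) (fun x => f x * G x + F x * g x) where
  memLp := memLp_mul_of_abs_le hF.memLp.1 hF.abs_le hG.memLp
  memLp_deriv := by
    refine MemLp.add ?_ (memLp_mul_of_abs_le hF.memLp.1 hF.abs_le hG.memLp_deriv)
    simpa only [mul_comm] using memLp_mul_of_abs_le hG.memLp.1 hG.abs_le hF.memLp_deriv
  isPrimitive := hF.isPrimitive.mul hF.locallyIntegrable_deriv hG.isPrimitive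
    hG.locallyIntegrable_deriv
  integrable := hF.memLp.integrable_mul hG.memLp
  integrable_deriv := (hF.memLp_deriv.integrable_mul hG.memLp).add
    (hF.memLp.integrable_mul hG.memLp_deriv)

namespace H1

theorem isW1Pair_mul (p q : H1) : IsW1Pair (fun x => p.rep x * q.rep x)
    (fun x => p.val.snd x * q.rep x + p.rep x * q.val.snd x) := p.isH1Pair.mul q.isH1Pair

theorem integral_rep_mul_deriv_sq_le (p q : H1) :
    ∫ x, (p.rep x * q.val.snd x) ^ 2 ≤ 4 * ‖p‖ ^ 2 * ‖q‖ ^ 2 :=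
  calc ∫ x, (p.rep x * q.val.snd x) ^ 2 ≤ (2 * ‖p‖) ^ 2 * ∫ x, q.val.snd x ^ 2 :=
        integral_mul_sq_le p.abs_rep_le q.isH1Pair.memLp_deriv
    _ ≤ (2 * ‖p‖) ^ 2 * ‖q‖ ^ 2 := by gcongr; exact q.integral_deriv_sq_le
    _ = 4 * ‖p‖ ^ 2 * ‖q‖ ^ 2 := by ring

theorem norm_mul_le (p q : H1) : ‖(p.isW1Pair_mul q).toH1‖ ≤ 5 * ‖p‖ * ‖q‖ := by
  refine abs_le_of_sq_le_sq' ?_ (by positivity) |>.2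
  have h_mul : ∫ x, (p.rep x * q.rep x) ^ 2 ≤ 4 * ‖p‖ ^ 2 * ‖q‖ ^ 2 :=
    calc ∫ x, (p.rep x * q.rep x) ^ 2 ≤ (2 * ‖p‖) ^ 2 * ∫ x, q.rep x ^ 2 :=
          integral_mul_sq_le p.abs_rep_le q.isH1Pair.memLp
      _ ≤ (2 * ‖p‖) ^ 2 * ‖q‖ ^ 2 := by gcongr; exact q.integral_rep_sq_le
      _ = 4 * ‖p‖ ^ 2 * ‖q‖ ^ 2 := by ring
  have h_deriv := integral_add_sq_le
    (memLp_mul_of_abs_le q.isH1Pair.memLp.1 q.abs_rep_le p.isH1Pair.memLp_deriv)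
    (memLp_mul_of_abs_le p.isH1Pair.memLp.1 p.abs_rep_le q.isH1Pair.memLp_deriv)
  simp only [IsH1Pair.norm_toH1_sq, mul_comm (p.val.snd _) (q.rep _)]
  nlinarith [p.integral_rep_mul_deriv_sq_le q, q.integral_rep_mul_deriv_sq_le p,
    mul_nonneg (sq_nonneg ‖p‖) (sq_nonneg ‖q‖)]

/-- The continuous bilinear map `b` on `H¹(ℝ)`; its bilinearity is checked on the continuous
representatives. -/
noncomputable def bilinOfRep (b : H1 → H1 → H1)
    (rep_add_left : ∀ p p' q, (b (p + p') q).rep = (b p q).rep + (b p' q).rep)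
    (rep_smul_left : ∀ (c : ℝ) p q, (b (c • p) q).rep = c • (b p q).rep)
    (rep_add_right : ∀ p q q', (b p (q + q')).rep = (b p q).rep + (b p q').rep)
    (rep_smul_right : ∀ (c : ℝ) p q, (b p (c • q)).rep = c • (b p q).rep)
    (K : ℝ) (norm_le : ∀ p q, ‖b p q‖ ≤ K * ‖p‖ * ‖q‖) : H1 →L[ℝ] H1 →L[ℝ] H1 :=
  LinearMap.mkContinuous₂
    (LinearMap.mk₂ ℝ b
      (fun p p' q => rep_injective ((rep_add_left p p' q).trans (rep_add _ _).symm))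
      (fun c p q => rep_injective ((rep_smul_left c p q).trans (rep_smul _ _).symm))
      (fun p q q' => rep_injective ((rep_add_right p q q').trans (rep_add _ _).symm))
      (fun c p q => rep_injective ((rep_smul_right c p q).trans (rep_smul _ _).symm)))
    K norm_le

/-- Multiplication on the Banach algebra `H¹(ℝ)`. -/
noncomputable def mulL : H1 →L[ℝ] H1 →L[ℝ] H1 :=
  bilinOfRep (fun p q => (p.isW1Pair_mul q).toH1)
    (fun p p' q => by funext x; simp [IsH1Pair.rep_toH1, rep_add, add_mul])
    (fun c p q => by funext x; simp [IsH1Pair.rep_toH1, rep_smul, mul_assoc])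
    (fun p q q' => by funext x; simp [IsH1Pair.rep_toH1, rep_add, mul_add])
    (fun c p q => by funext x; simp [IsH1Pair.rep_toH1, rep_smul, mul_left_comm])
    5 norm_mul_le

theorem rep_mulL (p q : H1) : (mulL p q).rep = fun x => p.rep x * q.rep x :=
  (p.isW1Pair_mul q).rep_toH1

end H1

/-! ### The Poisson kernels of the half-plane -/

/-- The conjugate Poisson kernel of the upper half-plane at height `ε`, without its factor `1/π`. -/
noncomputable def conjPoissonKernel (ε s : ℝ) : ℝ := s / (s ^ 2 + ε ^ 2)

/-- The Poisson kernel of the upper half-plane at height `ε`, without its factor `1/π`. -/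
noncomputable def halfPlanePoissonKernel (ε s : ℝ) : ℝ := ε / (s ^ 2 + ε ^ 2)

section Kernels

variable {ε : ℝ}

theorem continuous_conjPoissonKernel (hε : 0 < ε) : Continuous (conjPoissonKernel ε) :=
  continuous_id.div₀ (by fun_prop) fun s => by positivity

theorem continuous_halfPlanePoissonKernel (hε : 0 < ε) : Continuous (halfPlanePoissonKernel ε) :=
  continuous_const.div₀ (by fun_prop) fun s => by positivity

theorem conjPoissonKernel_neg (s : ℝ) : conjPoissonKernel ε (-s) = -conjPoissonKernel ε s := by
  simp only [conjPoissonKernel, neg_sq, neg_div]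

theorem halfPlanePoissonKernel_nonneg (hε : 0 < ε) (s : ℝ) : 0 ≤ halfPlanePoissonKernel ε s := by
  unfold halfPlanePoissonKernel; positivity

theorem abs_conjPoissonKernel_le_inv {s : ℝ} (hs : 0 < s) :
    |conjPoissonKernel ε s| ≤ s⁻¹ := by
  unfold conjPoissonKernel
  rw [abs_of_nonneg (by positivity), div_le_iff₀ (by positivity), mul_add, pow_two,
    inv_mul_cancel_left₀ hs.ne']
  exact le_add_of_nonneg_right (by positivity)

theorem abs_conjPoissonKernel_le (hε : 0 < ε) (s : ℝ) : |conjPoissonKernel ε s| ≤ ε⁻¹ := by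
  unfold conjPoissonKernel
  rw [abs_div, abs_of_pos (by positivity : 0 < s ^ 2 + ε ^ 2), div_le_iff₀ (by positivity),
    inv_mul_eq_div, le_div_iff₀ hε, ← sq_abs s]
  nlinarith [sq_nonneg (|s| - ε), sq_nonneg ε, sq_nonneg |s|]

theorem halfPlanePoissonKernel_eq (hε : 0 < ε) (s : ℝ) :
    halfPlanePoissonKernel ε s = ε⁻¹ * (1 + (s / ε) ^ 2)⁻¹ := by
  unfold halfPlanePoissonKernel
  field_simp
  ring

theorem integrable_halfPlanePoissonKernel (hε : 0 < ε) : Integrable (halfPlanePoissonKernel ε) := by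
  rw [funext (halfPlanePoissonKernel_eq hε)]
  exact (integrable_inv_one_add_sq.comp_div hε.ne').const_mul ε⁻¹

theorem integral_halfPlanePoissonKernel (hε : 0 < ε) :
    ∫ s, halfPlanePoissonKernel ε s = Real.pi := by
  simp only [halfPlanePoissonKernel_eq hε]
  rw [integral_const_mul, Measure.integral_comp_div (fun t : ℝ => (1 + t ^ 2)⁻¹),
    integral_univ_inv_one_add_sq, abs_of_pos hε, smul_eq_mul, inv_mul_cancel_left₀ hε.ne']

theorem memLp_conjPoissonKernel (hε : 0 < ε) : MemLp (conjPoissonKernel ε) 2 := by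
  have hc := continuous_conjPoissonKernel hε
  rw [memLp_two_iff_integrable_sq hc.aestronglyMeasurable]
  refine ((integrable_halfPlanePoissonKernel hε).const_mul ε⁻¹).mono'
    (hc.pow 2).aestronglyMeasurable (.of_forall fun s => ?_)
  rw [Real.norm_eq_abs, abs_of_nonneg (sq_nonneg _), conjPoissonKernel, halfPlanePoissonKernel,
    div_pow, div_le_iff₀ (by positivity)]
  field_simp
  exact le_add_of_nonneg_right (sq_nonneg ε)

theorem memLp_halfPlanePoissonKernel (hε : 0 < ε) : MemLp (halfPlanePoissonKernel ε) 2 := by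
  have hc := continuous_halfPlanePoissonKernel hε
  rw [memLp_two_iff_integrable_sq hc.aestronglyMeasurable]
  refine ((integrable_halfPlanePoissonKernel hε).const_mul ε⁻¹).mono'
    (hc.pow 2).aestronglyMeasurable (.of_forall fun s => ?_)
  rw [Real.norm_eq_abs, abs_of_nonneg (sq_nonneg _), halfPlanePoissonKernel,
    div_pow, div_le_iff₀ (by positivity)]
  field_simp
  exact le_add_of_nonneg_left (sq_nonneg s)

theorem integrable_conjPoissonKernel_sub (hε : 0 < ε) (d : ℝ) :
    Integrable fun s => conjPoissonKernel ε s - conjPoissonKernel ε (s + d) := by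
  have hd := measurePreserving_add_right (volume : Measure ℝ) d
  have h_eq : ∀ s, conjPoissonKernel ε s - conjPoissonKernel ε (s + d) =
      d * (conjPoissonKernel ε s * conjPoissonKernel ε (s + d) -
        halfPlanePoissonKernel ε s * halfPlanePoissonKernel ε (s + d)) := fun s => by
    unfold conjPoissonKernel halfPlanePoissonKernel
    field_simp
    ring
  rw [funext h_eq]
  exact (((memLp_conjPoissonKernel hε).integrable_mul
    ((memLp_conjPoissonKernel hε).comp_measurePreserving hd)).sub
    ((memLp_halfPlanePoissonKernel hε).integrable_mul
      ((memLp_halfPlanePoissonKernel hε).comp_measurePreserving hd))).const_mul d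

theorem tendsto_log_sub_log {l : Filter ℝ} (hl : Tendsto (fun s : ℝ => s⁻¹) l (𝓝 0))
    (h0 : ∀ᶠ s in l, s ≠ 0) (hε : 0 < ε) (d : ℝ) :
    Tendsto (fun s => Real.log (s ^ 2 + ε ^ 2) - Real.log ((s + d) ^ 2 + ε ^ 2)) l (𝓝 0) := by
  have h_cont : ContinuousAt (fun t : ℝ => Real.log ((1 + ε ^ 2 * t ^ 2) /
      ((1 + d * t) ^ 2 + ε ^ 2 * t ^ 2))) 0 := by
    refine ContinuousAt.log (ContinuousAt.div (by fun_prop) (by fun_prop) (by simp)) (by simp)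
  have h_lim := h_cont.tendsto.comp hl
  simp only [ne_eq, OfNat.ofNat_ne_zero, not_false_eq_true, zero_pow, mul_zero, add_zero, one_pow,
    div_one, Real.log_one] at h_lim
  refine h_lim.congr' ?_
  filter_upwards [h0] with s hs
  rw [← Real.log_div (by positivity) (by positivity)]
  refine congrArg Real.log ?_
  field_simp

theorem hasDerivAt_half_log_sq_add_sq (hε : 0 < ε) (d s : ℝ) :
    HasDerivAt (fun s => 2⁻¹ * Real.log ((s + d) ^ 2 + ε ^ 2)) (conjPoissonKernel ε (s + d)) s := by
  have h : HasDerivAt (fun s : ℝ => (s + d) ^ 2 + ε ^ 2) (2 * (s + d)) s := by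
    simpa using (((hasDerivAt_id s).add_const d).pow 2).add_const (ε ^ 2)
  convert! (h.log (by positivity)).const_mul 2⁻¹ using 1
  rw [conjPoissonKernel, mul_div_assoc, inv_mul_cancel_left₀ two_ne_zero]

theorem integral_conjPoissonKernel_sub (hε : 0 < ε) (d : ℝ) :
    ∫ s, (conjPoissonKernel ε s - conjPoissonKernel ε (s + d)) = 0 := by
  have h_deriv : ∀ s, HasDerivAt
      (fun s => 2⁻¹ * (Real.log (s ^ 2 + ε ^ 2) - Real.log ((s + d) ^ 2 + ε ^ 2)))
      (conjPoissonKernel ε s - conjPoissonKernel ε (s + d)) s := fun s => by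
    simpa only [add_zero, ← mul_sub] using
      (hasDerivAt_half_log_sq_add_sq hε 0 s).fun_sub (hasDerivAt_half_log_sq_add_sq hε d s)
  rw [integral_of_hasDerivAt_of_tendsto h_deriv (integrable_conjPoissonKernel_sub hε d)
    ((tendsto_log_sub_log tendsto_inv_atBot_zero (eventually_ne_atBot 0) hε d).const_mul _)
    ((tendsto_log_sub_log tendsto_inv_atTop_zero (eventually_ne_atTop 0) hε d).const_mul _),
    sub_self]

theorem conjPoissonKernel_mul_eq (hε : 0 < ε) {d : ℝ} (hd : d ≠ 0) (s : ℝ) :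
    conjPoissonKernel ε s * conjPoissonKernel ε (s + d) =
      (d ^ 2 + 2 * ε ^ 2) / (d * (d ^ 2 + 4 * ε ^ 2)) *
          (conjPoissonKernel ε s - conjPoissonKernel ε (s + d)) +
        ε / (d ^ 2 + 4 * ε ^ 2) *
          (halfPlanePoissonKernel ε s + halfPlanePoissonKernel ε (s + d)) := by
  unfold conjPoissonKernel halfPlanePoissonKernel
  field_simp
  ring

theorem integral_conjPoissonKernel_mul (hε : 0 < ε) {d : ℝ} (hd : d ≠ 0) :
    ∫ s, conjPoissonKernel ε s * conjPoissonKernel ε (s + d) =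
      Real.pi * halfPlanePoissonKernel (2 * ε) d := by
  have hP := integrable_halfPlanePoissonKernel hε
  have h_sum : Integrable fun s =>
      halfPlanePoissonKernel ε s + halfPlanePoissonKernel ε (s + d) :=
    hP.add (hP.comp_add_right d)
  simp only [conjPoissonKernel_mul_eq hε hd]
  rw [integral_add ((integrable_conjPoissonKernel_sub hε d).const_mul _)
    (h_sum.const_mul _), integral_const_mul, integral_const_mul,
    integral_conjPoissonKernel_sub hε, integral_add hP (hP.comp_add_right d),
    integral_add_right_eq_self (halfPlanePoissonKernel ε), integral_halfPlanePoissonKernel hε,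
    halfPlanePoissonKernel]
  ring

end Kernels

/-! ### Two estimates for convolutions -/

theorem integral_abs_mul_le {α : Type*} [MeasurableSpace α] {μ : Measure α} {f g : α → ℝ}
    (hf : MemLp f 2 μ) (hg : MemLp g 2 μ) :
    ∫ x, |f x * g x| ∂μ ≤ 2⁻¹ * ((∫ x, f x ^ 2 ∂μ) + ∫ x, g x ^ 2 ∂μ) := by
  rw [← integral_add hf.integrable_sq hg.integrable_sq, ← integral_const_mul]
  refine integral_mono (hf.integrable_mul hg).abs
    ((hf.integrable_sq.add hg.integrable_sq).const_mul _) fun x => ?_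
  dsimp only
  rw [abs_mul, ← sq_abs (f x), ← sq_abs (g x)]
  linarith [two_mul_le_add_sq |f x| |g x|]

theorem integrable_mul_comp_sub_mul_comp_sub {f k : ℝ → ℝ} (hf : Integrable f)
    (hk : Measurable k) (hk2 : MemLp k 2) :
    Integrable fun p : ℝ × (ℝ × ℝ) =>
      (f p.2.1 * f p.2.2) * (k (p.1 - p.2.1) * k (p.1 - p.2.2)) := by
  have hks : ∀ y : ℝ, MemLp (fun x => k (x - y)) 2 := fun y =>
    hk2.comp_measurePreserving (measurePreserving_sub_right volume y)
  have hff : Integrable fun q : ℝ × ℝ => f q.1 * f q.2 := hf.mul_prod hf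
  have h_meas : AEStronglyMeasurable fun p : ℝ × (ℝ × ℝ) =>
      (f p.2.1 * f p.2.2) * (k (p.1 - p.2.1) * k (p.1 - p.2.2)) :=
    (hff.1.comp_snd (μ := (volume : Measure ℝ))).mul
      ((hk.comp (by fun_prop)).mul (hk.comp (by fun_prop))).aestronglyMeasurable
  refine (integrable_prod_iff' h_meas).2
    ⟨.of_forall fun q => ((hks q.1).integrable_mul (hks q.2)).const_mul (f q.1 * f q.2), ?_⟩
  refine (hff.abs.mul_const (∫ s, k s ^ 2)).mono' h_meas.norm.prod_swap.integral_prod_right'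
    (.of_forall fun q => ?_)
  rw [Real.norm_eq_abs, abs_of_nonneg (integral_nonneg fun _ => norm_nonneg _)]
  simp only [norm_mul (f q.1 * f q.2), Real.norm_eq_abs]
  rw [integral_const_mul]
  refine mul_le_mul_of_nonneg_left ((integral_abs_mul_le (hks q.1) (hks q.2)).trans_eq ?_)
    (abs_nonneg _)
  rw [integral_sub_right_eq_self (fun s => k s ^ 2), integral_sub_right_eq_self (fun s => k s ^ 2)]
  ring

theorem integral_mul_mul_comp_sub_le {f k : ℝ → ℝ} (hf : MemLp f 2) (hk : Integrable k)
    (hk0 : ∀ s, 0 ≤ k s) :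
    ∫ q : ℝ × ℝ, (f q.1 * f q.2) * k (q.1 - q.2) ≤ (∫ s, k s) * ∫ x, f x ^ 2 := by
  have h_snd : Integrable fun q : ℝ × ℝ => f q.2 ^ 2 * k (q.1 - q.2) :=
    hf.integrable_sq.convolution_integrand (ContinuousLinearMap.mul ℝ ℝ) hk
  have h_fst : Integrable fun q : ℝ × ℝ => f q.1 ^ 2 * k (q.1 - q.2) := by
    refine (hf.integrable_sq.convolution_integrand (ContinuousLinearMap.mul ℝ ℝ)
      hk.comp_neg).swap.congr (.of_forall fun q => ?_)
    simp only [Function.comp_apply, Prod.fst_swap, Prod.snd_swap, ContinuousLinearMap.mul_apply',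
      neg_sub]
  have h_int_snd : ∫ q : ℝ × ℝ, f q.2 ^ 2 * k (q.1 - q.2) = (∫ s, k s) * ∫ x, f x ^ 2 := by
    rw [Measure.volume_eq_prod, integral_prod_symm _ h_snd]
    simp only [integral_sub_right_eq_self k, integral_mul_const, mul_comm]
  have h_int_fst : ∫ q : ℝ × ℝ, f q.1 ^ 2 * k (q.1 - q.2) = (∫ s, k s) * ∫ x, f x ^ 2 := by
    rw [Measure.volume_eq_prod, integral_prod _ h_fst]
    simp only [integral_sub_left_eq_self k, integral_mul_const, mul_comm]
  have h_le : ∀ q : ℝ × ℝ, |(f q.1 * f q.2) * k (q.1 - q.2)| ≤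
      2⁻¹ * (f q.1 ^ 2 * k (q.1 - q.2) + f q.2 ^ 2 * k (q.1 - q.2)) := fun q => by
    rw [abs_mul, abs_of_nonneg (hk0 _), ← add_mul, ← mul_assoc, abs_mul, ← sq_abs (f q.1),
      ← sq_abs (f q.2)]
    refine mul_le_mul_of_nonneg_right ?_ (hk0 _)
    linarith [two_mul_le_add_sq |f q.1| |f q.2|]
  calc ∫ q : ℝ × ℝ, (f q.1 * f q.2) * k (q.1 - q.2)
      ≤ ∫ q : ℝ × ℝ, |(f q.1 * f q.2) * k (q.1 - q.2)| :=
        (le_abs_self _).trans (abs_integral_le_integral_abs)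
    _ ≤ ∫ q : ℝ × ℝ, 2⁻¹ * (f q.1 ^ 2 * k (q.1 - q.2) + f q.2 ^ 2 * k (q.1 - q.2)) :=
        integral_mono_of_nonneg (.of_forall fun q => abs_nonneg _)
          ((h_fst.add h_snd).const_mul _) (.of_forall h_le)
    _ = (∫ s, k s) * ∫ x, f x ^ 2 := by
        rw [integral_const_mul, integral_add h_fst h_snd, h_int_fst, h_int_snd]
        ring

/-! ### The conjugate Poisson integral -/

/-- The conjugate Poisson integral of `f` at height `ε`, without its factor `1/π`; as `ε → 0` it
tends to `π` times the Hilbert transform. -/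
noncomputable def conjPoisson (ε : ℝ) (f : ℝ → ℝ) (x : ℝ) : ℝ :=
  ∫ y, f y * conjPoissonKernel ε (x - y)

section ConjPoisson

variable {ε : ℝ} {f : ℝ → ℝ}

theorem aestronglyMeasurable_conjPoisson (hε : 0 < ε) (hf : Integrable f) :
    AEStronglyMeasurable (conjPoisson ε f) :=
  AEStronglyMeasurable.integral_prod_right' (μ := volume) (ν := volume)
    (f := fun p : ℝ × ℝ => f p.2 * conjPoissonKernel ε (p.1 - p.2))
    (hf.1.comp_snd.mul ((continuous_conjPoissonKernel hε).comp
      (continuous_fst.sub continuous_snd)).aestronglyMeasurable)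

theorem conjPoisson_sq (x : ℝ) :
    conjPoisson ε f x ^ 2 = ∫ q : ℝ × ℝ, (f q.1 * f q.2) *
      (conjPoissonKernel ε (x - q.1) * conjPoissonKernel ε (x - q.2)) := by
  simp only [mul_mul_mul_comm (f _) (f _)]
  rw [pow_two]
  exact (integral_prod_mul (fun y => f y * conjPoissonKernel ε (x - y))
    (fun y => f y * conjPoissonKernel ε (x - y))).symm

theorem memLp_conjPoisson (hε : 0 < ε) (hf : Integrable f) : MemLp (conjPoisson ε f) 2 := by
  rw [memLp_two_iff_integrable_sq (aestronglyMeasurable_conjPoisson hε hf)]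
  simp only [conjPoisson_sq]
  exact (integrable_mul_comp_sub_mul_comp_sub hf (continuous_conjPoissonKernel hε).measurable
    (memLp_conjPoissonKernel hε)).integral_prod_left

theorem ae_fst_ne_snd : ∀ᵐ q : ℝ × ℝ, q.1 ≠ q.2 := by
  rw [Measure.volume_eq_prod, Measure.ae_prod_iff_ae_ae
    (isOpen_ne_fun continuous_fst continuous_snd).measurableSet]
  exact .of_forall fun x => (Measure.ae_ne volume x).mono fun _ => Ne.symm

theorem integral_conjPoisson_sq_eq (hε : 0 < ε) (hf : Integrable f) :
    ∫ x, conjPoisson ε f x ^ 2 =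
      Real.pi * ∫ q : ℝ × ℝ, (f q.1 * f q.2) * halfPlanePoissonKernel (2 * ε) (q.1 - q.2) := by
  simp only [conjPoisson_sq]
  rw [integral_integral_swap (integrable_mul_comp_sub_mul_comp_sub hf
    (continuous_conjPoissonKernel hε).measurable (memLp_conjPoissonKernel hε)),
    ← integral_const_mul]
  refine integral_congr_ae ?_
  filter_upwards [ae_fst_ne_snd] with q hq
  have h_shift : ∀ x, conjPoissonKernel ε (x - q.2) =
      conjPoissonKernel ε (x - q.1 + (q.1 - q.2)) := fun x => by rw [sub_add_sub_cancel]
  simp only [h_shift]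
  rw [integral_const_mul, integral_sub_right_eq_self (fun s => conjPoissonKernel ε s *
    conjPoissonKernel ε (s + (q.1 - q.2))), integral_conjPoissonKernel_mul hε (sub_ne_zero.2 hq)]
  ring

theorem integral_conjPoisson_sq_le (hε : 0 < ε) (hf : Integrable f) (hf2 : MemLp f 2) :
    ∫ x, conjPoisson ε f x ^ 2 ≤ Real.pi ^ 2 * ∫ x, f x ^ 2 := by
  have h2ε : 0 < 2 * ε := by positivity
  rw [integral_conjPoisson_sq_eq hε hf, pow_two, mul_assoc]
  refine mul_le_mul_of_nonneg_left ((integral_mul_mul_comp_sub_le hf2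
    (integrable_halfPlanePoissonKernel h2ε) (halfPlanePoissonKernel_nonneg h2ε)).trans_eq ?_)
    Real.pi_pos.le
  rw [integral_halfPlanePoissonKernel h2ε]

theorem conjPoisson_eq (ε : ℝ) (f : ℝ → ℝ) (x : ℝ) :
    conjPoisson ε f x = ∫ s, f (x - s) * conjPoissonKernel ε s := by
  rw [← integral_sub_left_eq_self (fun s => f (x - s) * conjPoissonKernel ε s) volume x]
  simp only [sub_sub_cancel, conjPoisson]

end ConjPoisson

/-! ### The Hilbert transform -/

theorem integral_eq_integral_Ioi_add_neg {h : ℝ → ℝ} (hh : Integrable h) :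
    ∫ s, h s = ∫ s in Ioi (0 : ℝ), (h s + h (-s)) := by
  rw [integral_add hh.integrableOn hh.comp_neg.integrableOn, integral_comp_neg_Ioi, neg_zero,
    add_comm, intervalIntegral.integral_Iic_add_Ioi hh.integrableOn hh.integrableOn]

/-- The Hilbert transform, with the principal value folded onto the half-line: for `F ∈ H¹ ∩ L¹`
this integral converges absolutely at every point. -/
noncomputable def hilb (F : ℝ → ℝ) (x : ℝ) : ℝ :=
  Real.pi⁻¹ * ∫ s in Ioi (0 : ℝ), (F (x - s) - F (x + s)) * s⁻¹

theorem hilb_smul (c : ℝ) (F : ℝ → ℝ) : hilb (fun x => c * F x) = c • hilb F := by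
  funext x
  simp only [hilb, Pi.smul_apply, smul_eq_mul, ← mul_sub, mul_assoc, integral_const_mul]
  ring

section ConjPoisson

variable {ε : ℝ} {f : ℝ → ℝ}

theorem integrable_comp_sub_mul_conjPoissonKernel (hε : 0 < ε) (hf : Integrable f) (x : ℝ) :
    Integrable fun s => f (x - s) * conjPoissonKernel ε s :=
  (hf.comp_sub_left x).mul_bdd (continuous_conjPoissonKernel hε).aestronglyMeasurable
    (.of_forall fun _ => abs_conjPoissonKernel_le hε _)

theorem conjPoisson_eq_integral_Ioi (hε : 0 < ε) (hf : Integrable f) (x : ℝ) :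
    conjPoisson ε f x = ∫ s in Ioi (0 : ℝ), (f (x - s) - f (x + s)) * conjPoissonKernel ε s := by
  rw [conjPoisson_eq,
    integral_eq_integral_Ioi_add_neg (integrable_comp_sub_mul_conjPoissonKernel hε hf x)]
  simp only [conjPoissonKernel_neg, sub_neg_eq_add, mul_neg, ← sub_eq_add_neg, ← sub_mul]

theorem integrable_uncurry_comp_sub_mul_conjPoissonKernel (hε : 0 < ε) (hf : Integrable f)
    (μ : Measure ℝ) [IsFiniteMeasure μ] :
    Integrable (Function.uncurry fun t s => f (t - s) * conjPoissonKernel ε s)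
      (μ.prod volume) := by
  have h_shift : Integrable (fun p : ℝ × ℝ => f (p.1 - p.2)) (μ.prod volume) := by
    refine (((integrable_const (1 : ℝ)).convolution_integrand (ContinuousLinearMap.mul ℝ ℝ)
      hf.comp_neg).swap).congr (.of_forall fun p => ?_)
    simp only [Function.comp_apply, Prod.fst_swap, Prod.snd_swap, ContinuousLinearMap.mul_apply',
      one_mul, neg_sub]
  exact h_shift.mul_bdd
    ((continuous_conjPoissonKernel hε).comp continuous_snd).aestronglyMeasurable
    (.of_forall fun p => abs_conjPoissonKernel_le hε p.2)

end ConjPoisson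

namespace IsW1Pair

variable {F g : ℝ → ℝ} {ε : ℝ}

theorem isPrimitive_conjPoisson (h : IsW1Pair F g) (hε : 0 < ε) :
    IsPrimitive (conjPoisson ε F) (conjPoisson ε g) := by
  intro x y
  have : IsFiniteMeasure (volume.restrict (uIoc x y)) :=
    isFiniteMeasure_restrict.2 measure_Ioc_lt_top.ne
  rw [conjPoisson_eq, conjPoisson_eq,
    ← integral_sub (integrable_comp_sub_mul_conjPoissonKernel hε h.integrable y)
      (integrable_comp_sub_mul_conjPoissonKernel hε h.integrable x)]
  simp only [conjPoisson_eq ε g]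
  rw [intervalIntegral_integral_swap
    (integrable_uncurry_comp_sub_mul_conjPoissonKernel hε h.integrable_deriv _)]
  simp only [intervalIntegral.integral_mul_const, intervalIntegral.integral_comp_sub_right,
    ← h.isPrimitive _ _, sub_mul]

theorem isH1Pair_conjPoisson (h : IsW1Pair F g) (hε : 0 < ε) :
    IsH1Pair (fun x => Real.pi⁻¹ * conjPoisson ε F x)
      (fun x => Real.pi⁻¹ * conjPoisson ε g x) where
  memLp := (memLp_conjPoisson hε h.integrable).const_mul _
  memLp_deriv := (memLp_conjPoisson hε h.integrable_deriv).const_mul _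
  isPrimitive x y := by
    rw [intervalIntegral.integral_const_mul, ← h.isPrimitive_conjPoisson hε, mul_sub]

theorem norm_toH1_conjPoisson_le (h : IsW1Pair F g) (hε : 0 < ε) :
    ‖(h.isH1Pair_conjPoisson hε).toH1‖ ≤ ‖h.toH1‖ := by
  refine (sq_le_sq₀ (norm_nonneg _) (norm_nonneg _)).1 ?_
  simp only [IsH1Pair.norm_toH1_sq, mul_pow, integral_const_mul, ← mul_add, inv_pow]
  rw [inv_mul_le_iff₀ (by positivity), mul_add]
  exact add_le_add (integral_conjPoisson_sq_le hε h.integrable h.memLp)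
    (integral_conjPoisson_sq_le hε h.integrable_deriv h.memLp_deriv)

end IsW1Pair

/-- A majorant of the integrand of `hilb F x`, where `g` is the derivative of `F`: the singularity
at `0` is tamed by the Hölder-1/2 continuity of `F`. -/
noncomputable def hilbertMajorant (F g : ℝ → ℝ) (x s : ℝ) : ℝ :=
  (Ioc (0 : ℝ) 1).indicator (fun s => 2 * √(∫ t, g t ^ 2) * s ^ (-(1 / 2) : ℝ)) s +
    (|F (x - s)| + |F (x + s)|)

theorem hilbertMajorant_nonneg (F g : ℝ → ℝ) (x s : ℝ) : 0 ≤ hilbertMajorant F g x s :=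
  add_nonneg (indicator_nonneg (fun t ht => mul_nonneg (by positivity)
    (Real.rpow_nonneg ht.1.le _)) s) (by positivity)

theorem IsH1Pair.abs_sub_mul_inv_le_hilbertMajorant {F g : ℝ → ℝ} (h : IsH1Pair F g) (x : ℝ)
    {s : ℝ} (hs : 0 < s) : |F (x - s) - F (x + s)| * s⁻¹ ≤ hilbertMajorant F g x s := by
  unfold hilbertMajorant
  by_cases hs1 : s ≤ 1
  · rw [indicator_of_mem (show s ∈ Ioc (0 : ℝ) 1 from ⟨hs, hs1⟩)]
    have h_sqrt : √|x - s - (x + s)| ≤ 2 * √s := by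
      rw [show x - s - (x + s) = -(2 * s) by ring, abs_neg, abs_of_pos (by positivity),
        Real.sqrt_le_left (by positivity), mul_pow, Real.sq_sqrt hs.le]
      linarith
    have h_rpow : s ^ (-(1 / 2) : ℝ) = √s * s⁻¹ := by
      rw [Real.sqrt_eq_rpow, ← Real.rpow_neg_one s, ← Real.rpow_add hs]
      norm_num
    calc |F (x - s) - F (x + s)| * s⁻¹ ≤ 2 * √s * √(∫ t, g t ^ 2) * s⁻¹ := by
          gcongr
          exact (h.abs_sub_le _ _).trans
            (mul_le_mul_of_nonneg_right h_sqrt (Real.sqrt_nonneg _))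
      _ = 2 * √(∫ t, g t ^ 2) * s ^ (-(1 / 2) : ℝ) := by rw [h_rpow]; ring
      _ ≤ _ := le_add_of_nonneg_right (by positivity)
  · rw [indicator_of_notMem fun hs' => hs1 hs'.2, zero_add]
    exact (mul_le_of_le_one_right (abs_nonneg _) (inv_le_one_of_one_le₀ (not_le.1 hs1).le)).trans
      (abs_sub _ _)

section HilbertMajorant

variable {F : ℝ → ℝ}

theorem integrable_indicator_mul_rpow_neg_half (c : ℝ) :
    Integrable ((Ioc (0 : ℝ) 1).indicator fun s => c * s ^ (-(1 / 2) : ℝ)) := by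
  rw [integrable_indicator_iff measurableSet_Ioc]
  exact ((intervalIntegrable_iff_integrableOn_Ioc_of_le zero_le_one).1
    (intervalIntegral.intervalIntegrable_rpow' (by norm_num))).const_mul c

theorem integrable_abs_comp_sub_add_abs_comp_add (hF : Integrable F) (x : ℝ) :
    Integrable fun s => |F (x - s)| + |F (x + s)| :=
  (hF.comp_sub_left x).abs.add (hF.comp_add_left x).abs

theorem integrable_hilbertMajorant (hF : Integrable F) (g : ℝ → ℝ) (x : ℝ) :
    Integrable (hilbertMajorant F g x) :=
  (integrable_indicator_mul_rpow_neg_half _).add (integrable_abs_comp_sub_add_abs_comp_add hF x)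

theorem integral_hilbertMajorant_eq (hF : Integrable F) (g : ℝ → ℝ) (x y : ℝ) :
    ∫ s, hilbertMajorant F g x s = ∫ s, hilbertMajorant F g y s := by
  have h_abs : ∀ z, ∫ s, (|F (z - s)| + |F (z + s)|) = (∫ s, |F s|) + ∫ s, |F s| := fun z => by
    rw [integral_add (hF.comp_sub_left z).abs (hF.comp_add_left z).abs,
      integral_sub_left_eq_self (fun s => |F s|) volume z,
      integral_add_left_eq_self (fun s => |F s|) z]
  unfold hilbertMajorant
  rw [integral_add (integrable_indicator_mul_rpow_neg_half _)
    (integrable_abs_comp_sub_add_abs_comp_add hF x), integral_add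
    (integrable_indicator_mul_rpow_neg_half _) (integrable_abs_comp_sub_add_abs_comp_add hF y),
    h_abs, h_abs]

end HilbertMajorant

theorem tendsto_conjPoissonKernel {s : ℝ} (hs : s ≠ 0) :
    Tendsto (fun ε => conjPoissonKernel ε s) (𝓝 0) (𝓝 s⁻¹) := by
  have h_cont : ContinuousAt (fun ε => conjPoissonKernel ε s) 0 :=
    ContinuousAt.div (by fun_prop) (by fun_prop) (by simpa using hs)
  have h_zero : conjPoissonKernel 0 s = s⁻¹ := by
    rw [conjPoissonKernel, zero_pow two_ne_zero, add_zero, pow_two, div_mul_cancel_left₀ hs]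
  exact h_zero ▸ h_cont.tendsto

theorem integral_setOf_lt_abs_sub_eq {F : ℝ → ℝ} (hF : Integrable F) {ε : ℝ} (hε : 0 < ε)
    (x : ℝ) : ∫ y in {y | ε < |x - y|}, F y / (x - y) =
      ∫ s in Ioi ε, (F (x - s) - F (x + s)) * s⁻¹ := by
  have h_meas : MeasurableSet {s : ℝ | ε < |s|} := measurableSet_lt measurable_const (by fun_prop)
  let k : ℝ → ℝ := {s : ℝ | ε < |s|}.indicator fun s => s⁻¹
  have hk : ∀ s, ‖k s‖ ≤ ε⁻¹ := fun s => by
    rw [norm_indicator_eq_indicator_norm]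
    refine indicator_apply_le' (fun hs => ?_) fun _ => by positivity
    rw [norm_inv, Real.norm_eq_abs]
    exact inv_anti₀ hε (mem_ofPred.1 hs).le
  have h_int : Integrable fun s => F (x - s) * k s :=
    (hF.comp_sub_left x).mul_bdd (measurable_inv.indicator h_meas).aestronglyMeasurable
      (.of_forall hk)
  calc ∫ y in {y | ε < |x - y|}, F y / (x - y)
    _ = ∫ s, F (x - s) * k s := by
      rw [← integral_indicator (measurableSet_lt measurable_const (by fun_prop)),
        ← integral_sub_left_eq_self _ volume x]
      simp only [k, indicator, mem_ofPred_eq, sub_sub_cancel, div_eq_mul_inv, mul_ite, mul_zero]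
    _ = ∫ s in Ioi 0, (Ioi ε).indicator (fun s => (F (x - s) - F (x + s)) * s⁻¹) s := by
      rw [integral_eq_integral_Ioi_add_neg h_int]
      refine setIntegral_congr_fun measurableSet_Ioi fun s hs => ?_
      simp only [k, indicator, mem_ofPred_eq, mem_Ioi, abs_neg, abs_of_pos (mem_Ioi.1 hs),
        sub_neg_eq_add, inv_neg]
      split_ifs <;> ring
    _ = ∫ s in Ioi ε, (F (x - s) - F (x + s)) * s⁻¹ := by
      rw [setIntegral_indicator measurableSet_Ioi, Ioi_inter_Ioi, sup_eq_right.2 hε.le]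

namespace IsW1Pair

variable {F g : ℝ → ℝ}

theorem integrableOn_sub_mul (h : IsW1Pair F g) (x : ℝ) {k : ℝ → ℝ} (hk : Measurable k)
    (hk' : ∀ s, 0 < s → |k s| ≤ s⁻¹) :
    IntegrableOn (fun s => (F (x - s) - F (x + s)) * k s) (Ioi 0) := by
  have hc := h.continuous
  refine (integrable_hilbertMajorant h.integrable g x).integrableOn.mono'
    ((by fun_prop : Continuous fun s => F (x - s) - F (x + s)).measurable.mul
      hk).aestronglyMeasurable ?_
  filter_upwards [ae_restrict_mem measurableSet_Ioi] with s hs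
  rw [Real.norm_eq_abs, abs_mul]
  exact (mul_le_mul_of_nonneg_left (hk' s hs) (abs_nonneg _)).trans
    (h.abs_sub_mul_inv_le_hilbertMajorant x hs)

theorem integrableOn_sub_mul_inv (h : IsW1Pair F g) (x : ℝ) :
    IntegrableOn (fun s => (F (x - s) - F (x + s)) * s⁻¹) (Ioi 0) :=
  h.integrableOn_sub_mul x measurable_inv fun _ hs => (abs_of_pos (inv_pos.2 hs)).le

theorem tendsto_conjPoisson (h : IsW1Pair F g) (x : ℝ) :
    Tendsto (fun ε => Real.pi⁻¹ * conjPoisson ε F x) (𝓝[>] 0) (𝓝 (hilb F x)) := by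
  have h_dom : Tendsto
      (fun ε => ∫ s in Ioi (0 : ℝ), (F (x - s) - F (x + s)) * conjPoissonKernel ε s)
      (𝓝[>] 0) (𝓝 (∫ s in Ioi (0 : ℝ), (F (x - s) - F (x + s)) * s⁻¹)) := by
    refine tendsto_integral_filter_of_dominated_convergence
      (fun s => |F (x - s) - F (x + s)| * s⁻¹) ?_ ?_ ?_ ?_
    · filter_upwards [self_mem_nhdsWithin] with ε hε
      exact (h.integrableOn_sub_mul x (continuous_conjPoissonKernel hε).measurable
        fun s hs => abs_conjPoissonKernel_le_inv hs).aestronglyMeasurable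
    · refine .of_forall fun ε => ?_
      filter_upwards [ae_restrict_mem measurableSet_Ioi] with s hs
      rw [Real.norm_eq_abs, abs_mul]
      exact mul_le_mul_of_nonneg_left (abs_conjPoissonKernel_le_inv hs) (abs_nonneg _)
    · refine (h.integrableOn_sub_mul_inv x).abs.congr ?_
      filter_upwards [ae_restrict_mem measurableSet_Ioi] with s hs
      rw [abs_mul, abs_of_pos (inv_pos.2 (mem_Ioi.1 hs))]
    · filter_upwards [ae_restrict_mem measurableSet_Ioi] with s hs
      exact ((tendsto_conjPoissonKernel (mem_Ioi.1 hs).ne').mono_left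
        nhdsWithin_le_nhds).const_mul _
  refine (h_dom.congr' ?_).const_mul _
  filter_upwards [self_mem_nhdsWithin] with ε hε
  rw [conjPoisson_eq_integral_Ioi hε h.integrable]

theorem exists_rep_eq_hilb (h : IsW1Pair F g) : ∃ r : H1, r.rep = hilb F ∧ ‖r‖ ≤ ‖h.toH1‖ := by
  have h_pos : ∀ n : ℕ, (0 : ℝ) < 1 / ((n : ℝ) + 1) := fun n => Nat.one_div_pos_of_nat
  refine H1.exists_rep_eq_of_tendsto (𝓕 := atTop)
    (fun n => h.norm_toH1_conjPoisson_le (h_pos n)) fun x => ?_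
  simp only [IsH1Pair.rep_toH1]
  exact (h.tendsto_conjPoisson x).comp (tendsto_nhdsWithin_iff.2
    ⟨tendsto_one_div_add_atTop_nhds_zero_nat, .of_forall h_pos⟩)

/-- The Hilbert transform of `F`, as an element of `H¹(ℝ)`. -/
noncomputable def hilbertTransform (h : IsW1Pair F g) : H1 := h.exists_rep_eq_hilb.choose

theorem rep_hilbertTransform (h : IsW1Pair F g) : h.hilbertTransform.rep = hilb F :=
  h.exists_rep_eq_hilb.choose_spec.1

theorem norm_hilbertTransform_le (h : IsW1Pair F g) : ‖h.hilbertTransform‖ ≤ ‖h.toH1‖ :=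
  h.exists_rep_eq_hilb.choose_spec.2

theorem hasHilbertTransformAt (h : IsW1Pair F g) (x : ℝ) :
    HasHilbertTransformAt F x (hilb F x) := by
  rw [HasHilbertTransformAt, hilb, one_div]
  refine Tendsto.const_mul _ (((aecover_Ioi_of_Ioi
    (tendsto_id.mono_left nhdsWithin_le_nhds)).integral_tendsto_of_countably_generated
      (h.integrableOn_sub_mul_inv x)).congr' ?_)
  filter_upwards [self_mem_nhdsWithin] with ε hε
  rw [Measure.restrict_restrict measurableSet_Ioi, id, Ioi_inter_Ioi,
    sup_eq_left.2 (mem_Ioi.1 hε).le, integral_setOf_lt_abs_sub_eq h.integrable hε]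

theorem hilb_add {G k : ℝ → ℝ} (h : IsW1Pair F g) (h' : IsW1Pair G k) :
    hilb (fun x => F x + G x) = hilb F + hilb G := by
  funext x
  simp only [hilb, Pi.add_apply]
  rw [← mul_add, ← integral_add (h.integrableOn_sub_mul_inv x) (h'.integrableOn_sub_mul_inv x)]
  simp only [add_sub_add_comm, add_mul]

end IsW1Pair

namespace H1

/-- The bilinear map `(p, q) ↦ H(p q)` on `H¹(ℝ)`. -/
noncomputable def hilbMulL : H1 →L[ℝ] H1 →L[ℝ] H1 :=
  bilinOfRep (fun p q => (p.isW1Pair_mul q).hilbertTransform)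
    (fun p p' q => by
      simp only [IsW1Pair.rep_hilbertTransform, rep_add, Pi.add_apply, add_mul]
      exact (p.isW1Pair_mul q).hilb_add (p'.isW1Pair_mul q))
    (fun c p q => by
      simp only [IsW1Pair.rep_hilbertTransform, rep_smul, Pi.smul_apply, smul_eq_mul, mul_assoc,
        hilb_smul])
    (fun p q q' => by
      simp only [IsW1Pair.rep_hilbertTransform, rep_add, Pi.add_apply, mul_add]
      exact (p.isW1Pair_mul q).hilb_add (p.isW1Pair_mul q'))
    (fun c p q => by
      simp only [IsW1Pair.rep_hilbertTransform, rep_smul, Pi.smul_apply, smul_eq_mul,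
        mul_left_comm (p.rep _), hilb_smul])
    5 fun p q => (p.isW1Pair_mul q).norm_hilbertTransform_le.trans (norm_mul_le p q)

theorem rep_hilbMulL (p q : H1) : (hilbMulL p q).rep = hilb fun x => p.rep x * q.rep x :=
  (p.isW1Pair_mul q).rep_hilbertTransform

end H1

/-! ### The first moment of `F H F` -/

theorem integral_integral_mul_comp_sub {F G : ℝ → ℝ} (hF : Integrable F) (hG : Integrable G) :
    ∫ s, ∫ x, F x * G (x - s) = (∫ x, F x) * ∫ x, G x := by
  simpa [convolution_def, integral_neg_eq_self] using
    integral_convolution (ContinuousLinearMap.mul ℝ ℝ) hF hG.comp_neg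

theorem integrable_integral_mul_comp_sub {F G : ℝ → ℝ} (hF : Integrable F) (hG : Integrable G) :
    Integrable fun s => ∫ x, F x * G (x - s) := by
  refine (hF.integrable_convolution (ContinuousLinearMap.mul ℝ ℝ) hG.comp_neg).congr
    (.of_forall fun s => ?_)
  simp only [convolution_def, ContinuousLinearMap.mul_apply', neg_sub]

theorem integral_mul_comp_sub_neg (F : ℝ → ℝ) (s : ℝ) :
    ∫ x, F x * F (x - -s) = ∫ x, F x * F (x - s) := by
  rw [← integral_sub_right_eq_self (fun x => F x * F (x - -s)) s]
  simp only [sub_neg_eq_add, sub_add_cancel, mul_comm]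

theorem two_mul_integral_Ioi_integral_mul_comp_sub {F : ℝ → ℝ} (hF : Integrable F) :
    2 * ∫ s in Ioi (0 : ℝ), ∫ x, F x * F (x - s) = (∫ x, F x) ^ 2 := by
  rw [pow_two, ← integral_integral_mul_comp_sub hF hF,
    integral_eq_integral_Ioi_add_neg (integrable_integral_mul_comp_sub hF hF)]
  simp only [integral_mul_comp_sub_neg, ← two_mul, integral_const_mul]

/-- Symmetrisation: translating the second term by `s` replaces the weight `x - a` by the difference
`(x - a) - (x - s - a) = s`, which cancels the kernel `s⁻¹`. -/
theorem IsH1Pair.integral_sub_mul_mul_sub_mul_inv {F g : ℝ → ℝ} (h : IsH1Pair F g) {a : ℝ}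
    (hF : Integrable fun x => (x - a) * F x) {s : ℝ} (hs : s ≠ 0) :
    ∫ x, (x - a) * F x * ((F (x - s) - F (x + s)) * s⁻¹) = ∫ x, F x * F (x - s) := by
  have hc := h.continuous
  have h_sub : Integrable fun x => (x - a) * F x * F (x - s) :=
    hF.mul_bdd (by fun_prop) (.of_forall fun x => h.abs_le _)
  have h_add : Integrable fun x => (x - a) * F x * F (x + s) :=
    hF.mul_bdd (by fun_prop) (.of_forall fun x => h.abs_le _)
  calc ∫ x, (x - a) * F x * ((F (x - s) - F (x + s)) * s⁻¹)
    _ = ((∫ x, (x - a) * F x * F (x - s)) - ∫ x, (x - a) * F x * F (x + s)) * s⁻¹ := by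
      simp only [← mul_assoc, mul_sub]
      rw [integral_mul_const, integral_sub h_sub h_add]
    _ = ((∫ x, (x - a) * F x * F (x - s)) -
        ∫ x, (x - s - a) * F (x - s) * F (x - s + s)) * s⁻¹ := by
      rw [integral_sub_right_eq_self (fun x => (x - a) * F x * F (x + s)) s]
    _ = (∫ x, s * (F x * F (x - s))) * s⁻¹ := by
      rw [← integral_sub h_sub (h_add.comp_sub_right s)]
      congr 2 with x
      rw [sub_add_cancel]
      ring
    _ = ∫ x, F x * F (x - s) := by
      rw [integral_const_mul, mul_comm s, mul_inv_cancel_right₀ hs]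

namespace IsW1Pair

variable {F g ψ : ℝ → ℝ}

theorem integrable_mul_sub_mul_inv (h : IsW1Pair F g) (hψ : Integrable ψ) :
    Integrable (Function.uncurry fun x s => ψ x * ((F (x - s) - F (x + s)) * s⁻¹))
      (volume.prod (volume.restrict (Ioi 0))) := by
  have hc := h.continuous
  have h_meas : AEStronglyMeasurable
      (Function.uncurry fun x s => ψ x * ((F (x - s) - F (x + s)) * s⁻¹))
      (volume.prod (volume.restrict (Ioi 0))) :=
    hψ.1.comp_fst.mul ((by fun_prop : Continuous fun p : ℝ × ℝ =>
      F (p.1 - p.2) - F (p.1 + p.2)).measurable.mul measurable_snd.inv).aestronglyMeasurable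
  refine (integrable_prod_iff h_meas).2
    ⟨.of_forall fun x => (h.integrableOn_sub_mul_inv x).const_mul (ψ x), ?_⟩
  refine (hψ.abs.mul_const (∫ s, hilbertMajorant F g 0 s)).mono' h_meas.norm.integral_prod_right'
    (.of_forall fun x => ?_)
  rw [Real.norm_eq_abs, abs_of_nonneg (integral_nonneg fun _ => norm_nonneg _)]
  simp only [Function.uncurry, norm_mul (ψ x), Real.norm_eq_abs, integral_const_mul]
  refine mul_le_mul_of_nonneg_left ?_ (abs_nonneg _)
  have h_int := integrable_hilbertMajorant h.integrable g x
  calc ∫ s in Ioi 0, |(F (x - s) - F (x + s)) * s⁻¹|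
    _ ≤ ∫ s in Ioi 0, hilbertMajorant F g x s := by
      refine setIntegral_mono_on (h.integrableOn_sub_mul_inv x).abs h_int.integrableOn
        measurableSet_Ioi fun s hs => ?_
      rw [abs_mul, abs_of_pos (inv_pos.2 (mem_Ioi.1 hs))]
      exact h.abs_sub_mul_inv_le_hilbertMajorant x hs
    _ ≤ ∫ s, hilbertMajorant F g x s :=
      setIntegral_le_integral h_int (.of_forall (hilbertMajorant_nonneg F g x))
    _ = ∫ s, hilbertMajorant F g 0 s := integral_hilbertMajorant_eq h.integrable g x 0

theorem integral_sub_mul_mul_hilb (h : IsW1Pair F g) {a : ℝ}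
    (hF : Integrable fun x => (x - a) * F x) :
    ∫ x, (x - a) * F x * hilb F x = (2 * Real.pi)⁻¹ * (∫ x, F x) ^ 2 :=
  calc ∫ x, (x - a) * F x * hilb F x
    _ = Real.pi⁻¹ * ∫ x, ∫ s in Ioi (0 : ℝ),
        (x - a) * F x * ((F (x - s) - F (x + s)) * s⁻¹) := by
      simp only [integral_const_mul, hilb, mul_left_comm _ Real.pi⁻¹]
    _ = Real.pi⁻¹ * ∫ s in Ioi (0 : ℝ), ∫ x, F x * F (x - s) := by
      rw [integral_integral_swap (h.integrable_mul_sub_mul_inv hF)]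
      congr 1
      exact setIntegral_congr_fun measurableSet_Ioi fun s hs =>
        h.integral_sub_mul_mul_sub_mul_inv hF (ne_of_gt hs)
    _ = (2 * Real.pi)⁻¹ * (∫ x, F x) ^ 2 := by
      rw [← two_mul_integral_Ioi_integral_mul_comp_sub h.integrable, mul_inv_rev]
      ring

end IsW1Pair

/-! ### Maximal solutions of autonomous equations -/

section MaximalSolution

variable {E F : Type*} [NormedAddCommGroup E] [NormedAddCommGroup F]

/-- `N` is Lipschitz on bounded sets, expressed with the closed balls centred at the origin. -/
def LipschitzOnBalls (N : E → F) : Prop :=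
  ∀ R : ℝ, ∃ K : NNReal, LipschitzOnWith K N (Metric.closedBall 0 R)

theorem norm_le_of_lipschitzOnWith_closedBall {N : E → F} {K : NNReal} {R : ℝ}
    (hN : LipschitzOnWith K N (Metric.closedBall 0 R)) {x : E} (hx : x ∈ Metric.closedBall 0 R) :
    ‖N x‖ ≤ K * R + ‖N 0‖ := by
  have h_norm_x : ‖x‖ ≤ R := mem_closedBall_zero_iff.1 hx
  have h_dist : ‖N x - N 0‖ ≤ K * ‖x - 0‖ :=
    hN.norm_sub_le hx (Metric.mem_closedBall_self ((norm_nonneg x).trans h_norm_x))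
  calc ‖N x‖ ≤ ‖N x - N 0‖ + ‖N 0‖ := norm_le_norm_sub_add _ _
    _ ≤ K * R + ‖N 0‖ := by
      rw [sub_zero] at h_dist
      gcongr
      exact h_dist.trans (by gcongr)

theorem LipschitzOnBalls.prodMk {G : Type*} [NormedAddCommGroup G] {N : E → F} {N' : E → G}
    (hN : LipschitzOnBalls N) (hN' : LipschitzOnBalls N') :
    LipschitzOnBalls fun x => (N x, N' x) := fun R => by
  obtain ⟨K, hK⟩ := hN R
  obtain ⟨K', hK'⟩ := hN' R
  exact ⟨max K K', hK.prodMk hK'⟩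

variable [NormedSpace ℝ E] [NormedSpace ℝ F]

theorem lipschitzOnBalls_bilinear (B : E →L[ℝ] E →L[ℝ] F) : LipschitzOnBalls fun x => B x x := by
  refine fun R => ⟨‖B‖₊ * (2 * ‖R‖₊), LipschitzOnWith.of_dist_le_mul fun x hx y hy => ?_⟩
  rw [mem_closedBall_zero_iff] at hx hy
  rw [dist_eq_norm, dist_eq_norm]
  calc ‖B x x - B y y‖ = ‖B x (x - y) + B (x - y) y‖ := by
        simp only [map_sub, sub_apply]
        abel_nf
    _ ≤ ‖B‖ * ‖x‖ * ‖x - y‖ + ‖B‖ * ‖x - y‖ * ‖y‖ :=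
        norm_add_le_of_le (B.le_opNorm₂ _ _) (B.le_opNorm₂ _ _)
    _ ≤ ‖B‖ * ‖R‖ * ‖x - y‖ + ‖B‖ * ‖x - y‖ * ‖R‖ := by
        gcongr
        · exact hx.trans (le_abs_self R)
        · exact hy.trans (le_abs_self R)
    _ = (‖B‖₊ * (2 * ‖R‖₊) : NNReal) * ‖x - y‖ := by
        push_cast
        ring

/-- `w` solves the initial value problem `w' = N(w)`, `w(0) = w₀` on `[0, T)`, with one-sided
derivative at `0`. -/
structure IsForwardSolution (N : E → E) (w₀ : E) (T : ℝ) (w : ℝ → E) : Prop where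
  pos : 0 < T
  initial : w 0 = w₀
  hasDerivWithinAt : ∀ t ∈ Ico 0 T, HasDerivWithinAt w (N (w t)) (Ico 0 T) t

/-- A solution on `[0, T)` of `w' = N(w)`, `w(0) = w₀` of which every other solution is a
restriction. -/
structure IsMaximalSolution (N : E → E) (w₀ : E) (T : ℝ) (w : ℝ → E) : Prop
    extends IsForwardSolution N w₀ T w where
  lifespan_le : ∀ T' w', IsForwardSolution N w₀ T' w' → T' ≤ T
  eqOn : ∀ T' w', IsForwardSolution N w₀ T' w' → EqOn w' w (Ico 0 T')

variable {N : E → E} {w₀ : E} {T T' : ℝ} {w w' : ℝ → E}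

theorem IsForwardSolution.continuousOn (h : IsForwardSolution N w₀ T w) :
    ContinuousOn w (Ico 0 T) := fun t ht => (h.hasDerivWithinAt t ht).continuousWithinAt

theorem IsForwardSolution.hasDerivWithinAt_Ici (h : IsForwardSolution N w₀ T w) {t : ℝ}
    (ht : t ∈ Ico 0 T) : HasDerivWithinAt w (N (w t)) (Ici t) t :=
  (h.hasDerivWithinAt t ht).mono_of_mem_nhdsWithin
    (mem_of_superset (Ico_mem_nhdsGE ht.2) (Ico_subset_Ico_left ht.1))

theorem IsForwardSolution.exists_norm_le (h : IsForwardSolution N w₀ T w) {t : ℝ} (ht : t < T) :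
    ∃ M, ∀ s ∈ Icc 0 t, ‖w s‖ ≤ M :=
  isCompact_Icc.exists_bound_of_continuousOn (h.continuousOn.mono (Icc_subset_Ico_right ht))

theorem IsForwardSolution.eq_of_mem (hN : LipschitzOnBalls N) (h : IsForwardSolution N w₀ T w)
    (h' : IsForwardSolution N w₀ T' w') {t : ℝ} (h_nonneg : 0 ≤ t) (hT : t < T) (hT' : t < T') :
    w t = w' t := by
  obtain ⟨M, hM⟩ := h.exists_norm_le hT
  obtain ⟨M', hM'⟩ := h'.exists_norm_le hT'
  obtain ⟨K, hK⟩ := hN (max M M')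
  exact ODE_solution_unique_of_mem_Icc_right (v := fun _ => N) (K := K)
    (s := fun _ => Metric.closedBall 0 (max M M')) (fun _ _ => hK)
    (h.continuousOn.mono (Icc_subset_Ico_right hT))
    (fun s hs => h.hasDerivWithinAt_Ici ⟨hs.1, hs.2.trans hT⟩)
    (fun s hs => mem_closedBall_zero_iff.2 <|
      (hM s (Ico_subset_Icc_self hs)).trans (le_max_left M M'))
    (h'.continuousOn.mono (Icc_subset_Ico_right hT'))
    (fun s hs => h'.hasDerivWithinAt_Ici ⟨hs.1, hs.2.trans hT'⟩)
    (fun s hs => mem_closedBall_zero_iff.2 <|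
      (hM' s (Ico_subset_Icc_self hs)).trans (le_max_right M M'))
    (h.initial.trans h'.initial.symm) ⟨h_nonneg, le_rfl⟩

theorem LipschitzOnBalls.exists_local_solution [CompleteSpace E] (hN : LipschitzOnBalls N)
    (M : ℝ) : ∃ τ : ℝ, 0 < τ ∧ ∀ (x : E) (t₀ : ℝ), ‖x‖ ≤ M → ∃ α : ℝ → E, α t₀ = x ∧
      ∀ t ∈ Icc t₀ (t₀ + τ), HasDerivWithinAt α (N (α t)) (Icc t₀ (t₀ + τ)) t := by
  obtain ⟨K, hK⟩ := hN (‖M‖ + 1)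
  set L : NNReal := K * (‖M‖₊ + 1) + ‖N 0‖₊ with hL
  have hτ : (0 : ℝ) < 1 / (L + 1) := by positivity
  refine ⟨1 / (L + 1), hτ, fun x t₀ hx => ?_⟩
  have h_subset : Metric.closedBall x (1 : NNReal) ⊆ Metric.closedBall 0 (‖M‖ + 1) := by
    refine Metric.closedBall_subset_closedBall' ?_
    rw [dist_zero_right, NNReal.coe_one]
    linarith [hx.trans (le_abs_self M), Real.norm_eq_abs M]
  have h_picard : IsPicardLindelof (fun _ => N) (tmin := t₀) (tmax := t₀ + 1 / (L + 1))
      ⟨t₀, left_mem_Icc.2 (le_add_of_nonneg_right hτ.le)⟩ x 1 0 L K := by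
    refine .of_time_independent (fun y hy => ?_) (hK.mono h_subset) ?_
    · simpa only [hL, NNReal.coe_add, NNReal.coe_mul, NNReal.coe_one, coe_nnnorm] using
        norm_le_of_lipschitzOnWith_closedBall hK (h_subset hy)
    · simp only [add_sub_cancel_left, sub_self, max_eq_left hτ.le, mul_one_div, NNReal.coe_one,
        NNReal.coe_zero, sub_zero]
      exact (div_le_one (by positivity)).2 (by linarith)
  exact h_picard.exists_eq_forall_mem_Icc_hasDerivWithinAt₀

theorem IsForwardSolution.extend (h : IsForwardSolution N w₀ T w) {t₀ τ : ℝ} (ht₀ : t₀ ∈ Ico 0 T)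
    (hτ : 0 < τ) {α : ℝ → E} (hα₀ : α t₀ = w t₀)
    (hα : ∀ t ∈ Icc t₀ (t₀ + τ), HasDerivWithinAt α (N (α t)) (Icc t₀ (t₀ + τ)) t) :
    ∃ w', IsForwardSolution N w₀ (t₀ + τ) w' := by
  classical
  set β : ℝ → E := fun t => if t ≤ t₀ then w t else α t
  have h_before : ∀ t, t ≤ t₀ → β t = w t := fun t ht => if_pos ht
  have h_after : ∀ t, t₀ ≤ t → β t = α t := fun t ht => by
    rcases ht.eq_or_lt with rfl | h_lt
    · rw [h_before _ le_rfl, hα₀]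
    · exact if_neg (not_le.2 h_lt)
  have h_deriv_before : ∀ t ∈ Icc 0 t₀, HasDerivWithinAt β (N (β t)) (Icc 0 t₀) t :=
    fun t ht => by
      rw [h_before t ht.2]
      exact ((h.hasDerivWithinAt t ⟨ht.1, ht.2.trans_lt ht₀.2⟩).mono
        (Icc_subset_Ico_right ht₀.2)).congr (fun s hs => h_before s hs.2) (h_before t ht.2)
  have h_deriv_after : ∀ t ∈ Icc t₀ (t₀ + τ),
      HasDerivWithinAt β (N (β t)) (Icc t₀ (t₀ + τ)) t := fun t ht => by
    rw [h_after t ht.1]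
    exact (hα t ht).congr (fun s hs => h_after s hs.1) (h_after t ht.1)
  refine ⟨β, by linarith [ht₀.1], (h_before 0 ht₀.1).trans h.initial, fun t ht => ?_⟩
  rcases lt_trichotomy t t₀ with h_lt | rfl | h_gt
  · refine (h_deriv_before t ⟨ht.1, h_lt.le⟩).mono_of_mem_nhdsWithin ?_
    filter_upwards [self_mem_nhdsWithin, nhdsWithin_le_nhds (Iio_mem_nhds h_lt)] with s hs hs'
    exact ⟨hs.1, (mem_Iio.1 hs').le⟩
  · refine ((h_deriv_before t ⟨ht.1, le_rfl⟩).union (h_deriv_after t ⟨le_rfl, ht.2.le⟩)).mono ?_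
    rw [Icc_union_Icc_eq_Icc ht.1 ht.2.le]
    exact Ico_subset_Icc_self
  · refine (h_deriv_after t ⟨h_gt.le, ht.2.le⟩).mono_of_mem_nhdsWithin ?_
    filter_upwards [self_mem_nhdsWithin, nhdsWithin_le_nhds (Ioi_mem_nhds h_gt)] with s hs hs'
    exact ⟨(mem_Ioi.1 hs').le, hs.2.le⟩

theorem LipschitzOnBalls.exists_isForwardSolution [CompleteSpace E] (hN : LipschitzOnBalls N)
    (w₀ : E) : ∃ T w, IsForwardSolution N w₀ T w := by
  obtain ⟨τ, hτ, h_local⟩ := hN.exists_local_solution ‖w₀‖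
  obtain ⟨α, hα₀, hα⟩ := h_local w₀ 0 le_rfl
  rw [zero_add] at hα
  exact ⟨τ, α, hτ, hα₀, fun t ht => (hα t (Ico_subset_Icc_self ht)).mono Ico_subset_Icc_self⟩

theorem LipschitzOnBalls.exists_isForwardSolution_of_isLUB (hN : LipschitzOnBalls N)
    (hT : IsLUB {T | ∃ w, IsForwardSolution N w₀ T w} T) (hpos : 0 < T) :
    ∃ w, IsForwardSolution N w₀ T w := by
  have h_exists : ∀ t < T, ∃ T' w', t < T' ∧ IsForwardSolution N w₀ T' w' := fun t ht => by
    obtain ⟨T', ⟨w', h'⟩, h_lt, -⟩ := hT.exists_between ht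
    exact ⟨T', w', h_lt, h'⟩
  choose! τ W h_lt hW using h_exists
  refine ⟨fun t => W t t, hpos, (hW 0 hpos).initial, fun t ht => ?_⟩
  have h_eq : EqOn (fun s => W s s) (W t) (Ico 0 (τ t)) := fun s hs => by
    have h_lt_T : s < T := hs.2.trans_le (hT.1 ⟨W t, hW t ht.2⟩)
    exact (hW s h_lt_T).eq_of_mem hN (hW t ht.2) hs.1 (h_lt s h_lt_T) hs.2
  refine (((hW t ht.2).hasDerivWithinAt t ⟨ht.1, h_lt t ht.2⟩).congr h_eq rfl
    ).mono_of_mem_nhdsWithin ?_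
  filter_upwards [self_mem_nhdsWithin, nhdsWithin_le_nhds (Iio_mem_nhds (h_lt t ht.2))]
    with s hs hs'
  exact ⟨hs.1, hs'⟩

theorem LipschitzOnBalls.exists_isMaximalSolution [CompleteSpace E] (hN : LipschitzOnBalls N)
    (h_bdd : BddAbove {T | ∃ w, IsForwardSolution N w₀ T w}) :
    ∃ T w, IsMaximalSolution N w₀ T w := by
  obtain ⟨T₁, w₁, h₁⟩ := hN.exists_isForwardSolution w₀
  have h_nonempty : {T | ∃ w, IsForwardSolution N w₀ T w}.Nonempty := ⟨T₁, w₁, h₁⟩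
  have h_lub := isLUB_csSup h_nonempty h_bdd
  obtain ⟨w, hw⟩ :=
    hN.exists_isForwardSolution_of_isLUB h_lub (h₁.pos.trans_le (h_lub.1 ⟨w₁, h₁⟩))
  have h_le : ∀ T' w', IsForwardSolution N w₀ T' w' → T' ≤ _ := fun _ w' h' => h_lub.1 ⟨w', h'⟩
  exact ⟨_, w, hw, h_le, fun T' w' h' t ht =>
    h'.eq_of_mem hN hw ht.1 ht.2 (ht.2.trans_le (h_le T' w' h'))⟩

theorem IsMaximalSolution.tendsto_norm_atTop [CompleteSpace E] (hN : LipschitzOnBalls N)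
    (h : IsMaximalSolution N w₀ T w) : Tendsto (fun t => ‖w t‖) (𝓝[<] T) atTop := by
  rw [tendsto_atTop]
  intro M
  by_contra h_not_eventually
  obtain ⟨τ, hτ, h_local⟩ := hN.exists_local_solution M
  have h_near : ∀ᶠ t in 𝓝[<] T, t ∈ Ioo (max 0 (T - τ)) T :=
    Ioo_mem_nhdsLT (max_lt h.pos (by linarith))
  obtain ⟨t, h_norm, h_lt, ht⟩ :=
    ((not_eventually.1 h_not_eventually).and_eventually h_near).exists
  rw [max_lt_iff] at h_lt
  obtain ⟨α, hα₀, hα⟩ := h_local (w t) t (not_le.1 h_norm).le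
  obtain ⟨w', hw'⟩ := h.extend ⟨h_lt.1.le, ht⟩ hτ hα₀ hα
  linarith [h.lifespan_le _ w' hw', h_lt.2]

end MaximalSolution

/-! ### The system as an autonomous equation in `H¹ × H¹` -/

/-- The vector field `(u, v) ↦ (2uv, H(u²))` on `H¹ × H¹`. -/
noncomputable def modelField (w : H1 × H1) : H1 × H1 :=
  ((2 : ℝ) • H1.mulL w.1 w.2, H1.hilbMulL w.1 w.1)

theorem lipschitzOnBalls_modelField : LipschitzOnBalls modelField :=
  (lipschitzOnBalls_bilinear (((2 : ℝ) • H1.mulL).bilinearComp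
      (ContinuousLinearMap.fst ℝ H1 H1) (ContinuousLinearMap.snd ℝ H1 H1))).prodMk
    (lipschitzOnBalls_bilinear (H1.hilbMulL.bilinearComp
      (ContinuousLinearMap.fst ℝ H1 H1) (ContinuousLinearMap.fst ℝ H1 H1)))

theorem HasHilbertTransformAt.congr_ae {f g : ℝ → ℝ} {x l : ℝ} (hf : HasHilbertTransformAt f x l)
    (h : f =ᵐ[volume] g) : HasHilbertTransformAt g x l := by
  refine Tendsto.congr (fun ε => ?_) hf
  congr 1
  refine integral_congr_ae (ae_restrict_of_ae ?_)
  filter_upwards [h] with y hy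
  rw [hy]

theorem H1.rep_two_smul_mulL (p q : H1) (x : ℝ) :
    ((2 : ℝ) • H1.mulL p q).rep x = 2 * p.rep x * q.rep x := by
  rw [H1.rep_smul, Pi.smul_apply, H1.rep_mulL, smul_eq_mul, mul_assoc]

theorem H1.hasHilbertTransformAt_hilbMulL (p : H1) (x : ℝ) :
    HasHilbertTransformAt (fun y => p.fn y ^ 2) x ((H1.hilbMulL p p).rep x) := by
  rw [H1.rep_hilbMulL]
  refine ((p.isW1Pair_mul p).hasHilbertTransformAt x).congr_ae ?_
  filter_upwards [p.rep_ae_eq] with y hy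
  rw [hy, pow_two]

theorem H1.eq_two_smul_mulL_iff {p q r : H1} :
    r = (2 : ℝ) • H1.mulL p q ↔ ∀ᵐ x : ℝ, r.fn x = 2 * p.fn x * q.fn x := by
  constructor
  · rintro rfl
    filter_upwards [((2 : ℝ) • H1.mulL p q).rep_ae_eq, p.rep_ae_eq, q.rep_ae_eq]
      with x h_prod hp hq
    rw [← h_prod, ← hp, ← hq, H1.rep_two_smul_mulL]
  · intro h
    refine H1.rep_injective (H1.rep_eq_of_ae_eq _ (H1.continuous_rep _) ?_)
    filter_upwards [h, p.rep_ae_eq, q.rep_ae_eq] with x hx hp hq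
    rw [hx, H1.rep_two_smul_mulL, hp, hq]

theorem H1.eq_hilbMulL_self_iff {p r : H1} :
    r = H1.hilbMulL p p ↔
      ∀ᵐ x : ℝ, HasHilbertTransformAt (fun y => p.fn y ^ 2) x (r.fn x) := by
  constructor
  · rintro rfl
    filter_upwards [(H1.hilbMulL p p).rep_ae_eq] with x hx
    rw [← hx]
    exact p.hasHilbertTransformAt_hilbMulL x
  · intro h
    refine H1.rep_injective (H1.rep_eq_of_ae_eq _ (H1.continuous_rep _) ?_)
    filter_upwards [h] with x hx
    exact tendsto_nhds_unique hx (p.hasHilbertTransformAt_hilbMulL x)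

section Equivalence

variable {u₀ v₀ : H1} {T : ℝ}

theorem IsForwardSolution.isH1Solution {w : ℝ → H1 × H1}
    (h : IsForwardSolution modelField (u₀, v₀) T w) :
    IsH1Solution u₀ v₀ T (fun t => (w t).1) (fun t => (w t).2) := by
  have h_unique : UniqueDiffOn ℝ (Ico 0 T) := uniqueDiffOn_Ico 0 T
  have h_field : ContinuousOn (fun t => modelField (w t)) (Ico 0 T) :=
    (by unfold modelField; fun_prop : Continuous modelField).comp_continuousOn h.continuousOn
  have h_fst : ∀ t ∈ Ico 0 T,
      HasDerivWithinAt (fun s => (w s).1) (modelField (w t)).1 (Ico 0 T) t :=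
    fun t ht => (h.hasDerivWithinAt t ht).fst
  have h_snd : ∀ t ∈ Ico 0 T,
      HasDerivWithinAt (fun s => (w s).2) (modelField (w t)).2 (Ico 0 T) t :=
    fun t ht => (h.hasDerivWithinAt t ht).snd
  have h_deriv_fst := fun t ht => (h_fst t ht).derivWithin (h_unique t ht)
  have h_deriv_snd := fun t ht => (h_snd t ht).derivWithin (h_unique t ht)
  exact
    { pos := h.pos
      initial_u := congrArg Prod.fst h.initial
      initial_v := congrArg Prod.snd h.initial
      contDiffOn_u := (contDiffOn_one_iff_derivWithin h_unique).2
        ⟨fun t ht => (h_fst t ht).differentiableWithinAt, h_field.fst.congr h_deriv_fst⟩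
      contDiffOn_v := (contDiffOn_one_iff_derivWithin h_unique).2
        ⟨fun t ht => (h_snd t ht).differentiableWithinAt, h_field.snd.congr h_deriv_snd⟩
      eq_u := fun t ht => H1.eq_two_smul_mulL_iff.1 (h_deriv_fst t ht)
      eq_v := fun t ht => H1.eq_hilbMulL_self_iff.1 (h_deriv_snd t ht) }

theorem IsH1Solution.isForwardSolution {u v : ℝ → H1} (h : IsH1Solution u₀ v₀ T u v) :
    IsForwardSolution modelField (u₀, v₀) T (fun t => (u t, v t)) where
  pos := h.pos
  initial := by rw [h.initial_u, h.initial_v]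
  hasDerivWithinAt t ht := by
    have h_u := ((h.contDiffOn_u.differentiableOn one_ne_zero) t ht).hasDerivWithinAt
    have h_v := ((h.contDiffOn_v.differentiableOn one_ne_zero) t ht).hasDerivWithinAt
    rw [H1.eq_two_smul_mulL_iff.2 (h.eq_u t ht)] at h_u
    rw [H1.eq_hilbMulL_self_iff.2 (h.eq_v t ht)] at h_v
    exact h_u.prodMk h_v

end Equivalence

/-! ### The differential inequality `F'' ≥ k F²` -/

section Lifespan

theorem one_div_sqrt_cube_add_one_le {z : ℝ} (hz : 0 ≤ z) :
    1 / √(z ^ 3 + 1) ≤ 2 * (1 + z) ^ (-(3 / 2) : ℝ) := by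
  have h_rpow : (1 + z) ^ (-(3 / 2) : ℝ) = 1 / √((1 + z) ^ 3) := by
    rw [Real.sqrt_eq_rpow, ← Real.rpow_natCast, ← Real.rpow_mul (by positivity),
      Real.rpow_neg (by positivity), one_div]
    norm_num
  have h_sqrt : √((1 + z) ^ 3) ≤ 2 * √(z ^ 3 + 1) := by
    rw [Real.sqrt_le_left (by positivity), mul_pow, Real.sq_sqrt (by positivity)]
    nlinarith [mul_nonneg hz (sq_nonneg (z - 1)), sq_nonneg (z - 1)]
  rw [h_rpow, mul_one_div, div_le_div_iff₀ (by positivity) (by positivity), one_mul]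
  exact h_sqrt

theorem continuous_one_div_sqrt_abs_cube_add_one :
    Continuous fun y : ℝ => 1 / √(|y| ^ 3 + 1) :=
  continuous_const.div₀ (by fun_prop) fun y => by positivity

theorem integrable_one_div_sqrt_abs_cube_add_one :
    Integrable fun y : ℝ => 1 / √(|y| ^ 3 + 1) := by
  have h_majorant : Integrable fun y : ℝ => 2 * (1 + ‖y‖) ^ (-(3 / 2) : ℝ) :=
    (integrable_one_add_norm (by norm_num)).const_mul 2
  refine h_majorant.mono' continuous_one_div_sqrt_abs_cube_add_one.aestronglyMeasurable
    (Eventually.of_forall fun y => ?_)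
  rw [Real.norm_of_nonneg (by positivity)]
  exact one_div_sqrt_cube_add_one_le (abs_nonneg y)

variable {F P Q : ℝ → ℝ} {T k : ℝ}

theorem le_of_hasDerivWithinAt_Ico_nonneg
    (hF : ∀ t ∈ Ico 0 T, HasDerivWithinAt F (P t) (Ico 0 T) t)
    (hP : ∀ t ∈ Ico 0 T, 0 ≤ P t) {t : ℝ} (ht : t ∈ Ico 0 T) : F 0 ≤ F t := by
  have h_interior : interior (Ico 0 T) ⊆ Ico 0 T := interior_subset
  exact monotoneOn_of_hasDerivWithinAt_nonneg (convex_Ico 0 T)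
    (fun s hs => (hF s hs).continuousWithinAt)
    (fun s hs => (hF s (h_interior hs)).mono h_interior)
    (fun s hs => hP s (h_interior hs)) ⟨le_rfl, ht.1.trans_lt ht.2⟩ ht ht.1

theorem intervalIntegral_le_integral_Ioi {q : ℝ → ℝ} {a : ℝ} (hq : IntegrableOn q (Ioi a))
    (h_nonneg : ∀ y, 0 ≤ q y) (b : ℝ) : ∫ y in a..b, q y ≤ ∫ y in Ioi a, q y := by
  rcases le_total a b with hab | hba
  · rw [intervalIntegral.integral_of_le hab]
    exact setIntegral_mono_set hq (Eventually.of_forall h_nonneg)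
      (Eventually.of_forall Ioc_subset_Ioi_self)
  · rw [intervalIntegral.integral_of_ge hba]
    exact (neg_nonpos.2 (integral_nonneg h_nonneg)).trans (integral_nonneg h_nonneg)

/-- Separation of variables: the left side of `h` is the time derivative of the antiderivative of
`q` evaluated at `F t`. -/
theorem lifespan_le_integral_Ioi {q : ℝ → ℝ} (hq : Continuous q) (hq_nonneg : ∀ y, 0 ≤ q y)
    (hq_int : IntegrableOn q (Ioi (F 0)))
    (hF : ∀ t ∈ Ico 0 T, HasDerivWithinAt F (P t) (Ico 0 T) t)
    (h : ∀ t ∈ Ico 0 T, 1 ≤ q (F t) * P t) : T ≤ ∫ y in Ioi (F 0), q y := by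
  have h_antideriv : ∀ z, HasDerivAt (fun z => ∫ y in F 0..z, q y) (q z) z := fun z =>
    intervalIntegral.integral_hasDerivAt_right (hq.intervalIntegrable _ _)
      (hq.stronglyMeasurableAtFilter _ _) hq.continuousAt
  have h_le : ∀ t ∈ Ico 0 T, t ≤ ∫ y in F 0..F t, q y := fun t ht => by
    have h_mono := le_of_hasDerivWithinAt_Ico_nonneg
      (F := fun t => (∫ y in F 0..F t, q y) - t) (P := fun t => q (F t) * P t - 1)
      (fun s hs => ((h_antideriv _).comp_hasDerivWithinAt s (hF s hs)).sub
        (hasDerivWithinAt_id s _))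
      (fun s hs => sub_nonneg.2 (h s hs)) ht
    rwa [intervalIntegral.integral_same, sub_zero, sub_nonneg] at h_mono
  refine le_of_forall_lt_imp_le_of_dense fun t ht => ?_
  rcases lt_or_ge t 0 with h_neg | h_nonneg
  · exact h_neg.le.trans (integral_nonneg hq_nonneg)
  · exact (h_le t ⟨h_nonneg, ht⟩).trans (intervalIntegral_le_integral_Ioi hq_int hq_nonneg _)

theorem le_and_deriv_le_of_deriv_deriv_ge (hk : 0 ≤ k)
    (hF : ∀ t ∈ Ico 0 T, HasDerivWithinAt F (P t) (Ico 0 T) t)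
    (hP : ∀ t ∈ Ico 0 T, HasDerivWithinAt P (Q t) (Ico 0 T) t)
    (hQ : ∀ t ∈ Ico 0 T, k * F t ^ 2 ≤ Q t) (hP₀ : 0 ≤ P 0) {t : ℝ} (ht : t ∈ Ico 0 T) :
    F 0 ≤ F t ∧ P 0 ≤ P t := by
  have h_deriv : ∀ s ∈ Ico 0 T, P 0 ≤ P s := fun s hs =>
    le_of_hasDerivWithinAt_Ico_nonneg hP
      (fun r hr => (mul_nonneg hk (sq_nonneg (F r))).trans (hQ r hr)) hs
  exact ⟨le_of_hasDerivWithinAt_Ico_nonneg hF (fun s hs => hP₀.trans (h_deriv s hs)) ht,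
    h_deriv t ht⟩

/-- The energy `P² - (2k/3) (F - F 0)³` has derivative `2 P (Q - k (F - F 0)²) ≥ 0`. -/
theorem sq_deriv_ge_of_deriv_deriv_ge (hk : 0 ≤ k)
    (hF : ∀ t ∈ Ico 0 T, HasDerivWithinAt F (P t) (Ico 0 T) t)
    (hP : ∀ t ∈ Ico 0 T, HasDerivWithinAt P (Q t) (Ico 0 T) t)
    (hQ : ∀ t ∈ Ico 0 T, k * F t ^ 2 ≤ Q t) (hF₀ : 0 ≤ F 0) (hP₀ : 0 ≤ P 0)
    {t : ℝ} (ht : t ∈ Ico 0 T) :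
    P 0 ^ 2 + 2 * k / 3 * (F t - F 0) ^ 3 ≤ P t ^ 2 := by
  have h_energy := le_of_hasDerivWithinAt_Ico_nonneg
    (F := fun s => P s ^ 2 - 2 * k / 3 * (F s - F 0) ^ 3)
    (P := fun s => 2 * P s * (Q s - k * (F s - F 0) ^ 2))
    (fun s hs => by
      convert! ((hP s hs).pow 2).sub ((((hF s hs).sub_const (F 0)).pow 3).const_mul (2 * k / 3))
        using 1
      ring)
    (fun s hs => by
      obtain ⟨hF_le, hP_le⟩ := le_and_deriv_le_of_deriv_deriv_ge hk hF hP hQ hP₀ hs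
      have h_sq : k * (F s - F 0) ^ 2 ≤ k * F s ^ 2 := by
        have : 0 ≤ F s - F 0 := sub_nonneg.2 hF_le
        gcongr
        linarith
      exact mul_nonneg (mul_nonneg zero_le_two (hP₀.trans hP_le))
        (sub_nonneg.2 (h_sq.trans (hQ s hs)))) ht
  simp only [sub_self, ne_eq, OfNat.ofNat_ne_zero, not_false_eq_true, zero_pow, mul_zero,
    sub_zero] at h_energy
  linarith

theorem rpow_neg_one_third_pow_three {x : ℝ} (hx : 0 ≤ x) :
    (x ^ (-(1 / 3) : ℝ)) ^ 3 = x⁻¹ := by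
  rw [← Real.rpow_natCast, ← Real.rpow_mul hx, Nat.cast_ofNat, neg_mul,
    one_div_mul_cancel three_ne_zero, Real.rpow_neg_one]

/-- In terms of `z = (F - F 0) / (μ P(0))` the energy inequality is the scale-free
`μ z' ≥ √(z³ + 1)`. -/
theorem mul_sqrt_rescaled_le_of_deriv_deriv_ge {μ : ℝ} (hμ : 0 < μ) (hk : 0 ≤ k)
    (h_scale : 2 * k / 3 * P 0 * μ ^ 3 = 1)
    (hF : ∀ t ∈ Ico 0 T, HasDerivWithinAt F (P t) (Ico 0 T) t)
    (hP : ∀ t ∈ Ico 0 T, HasDerivWithinAt P (Q t) (Ico 0 T) t)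
    (hQ : ∀ t ∈ Ico 0 T, k * F t ^ 2 ≤ Q t) (hF₀ : 0 ≤ F 0) (hP₀ : 0 < P 0)
    {t : ℝ} (ht : t ∈ Ico 0 T) :
    P 0 * √(|(F t - F 0) / (μ * P 0)| ^ 3 + 1) ≤ P t := by
  obtain ⟨hF_le, hP_le⟩ := le_and_deriv_le_of_deriv_deriv_ge hk hF hP hQ hP₀.le ht
  have h_nonneg : 0 ≤ (F t - F 0) / (μ * P 0) := div_nonneg (sub_nonneg.2 hF_le) (by positivity)
  rw [abs_of_nonneg h_nonneg, ← sq_le_sq₀ (by positivity) (hP₀.le.trans hP_le), mul_pow,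
    Real.sq_sqrt (by positivity)]
  have h_cube : P 0 ^ 2 * ((F t - F 0) / (μ * P 0)) ^ 3 = 2 * k / 3 * (F t - F 0) ^ 3 := by
    rw [div_pow, mul_pow, mul_div_assoc', div_eq_iff (by positivity)]
    linear_combination (-(F t - F 0) ^ 3 * P 0 ^ 2) * h_scale
  linarith [sq_deriv_ge_of_deriv_deriv_ge hk hF hP hQ hF₀ hP₀.le ht]

theorem lifespan_le_of_deriv_deriv_ge (hk : 0 < k)
    (hF : ∀ t ∈ Ico 0 T, HasDerivWithinAt F (P t) (Ico 0 T) t)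
    (hP : ∀ t ∈ Ico 0 T, HasDerivWithinAt P (Q t) (Ico 0 T) t)
    (hQ : ∀ t ∈ Ico 0 T, k * F t ^ 2 ≤ Q t) (hF₀ : 0 ≤ F 0) (hP₀ : 0 < P 0) :
    T ≤ (2 * k / 3 * P 0) ^ (-(1 / 3) : ℝ) * ∫ y in Ioi (0 : ℝ), 1 / √(y ^ 3 + 1) := by
  set μ : ℝ := (2 * k / 3 * P 0) ^ (-(1 / 3) : ℝ) with hμ_def
  have hμ : 0 < μ := by positivity
  have h_scale : 2 * k / 3 * P 0 * μ ^ 3 = 1 := by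
    rw [hμ_def, rpow_neg_one_third_pow_three (by positivity), mul_inv_cancel₀ (by positivity)]
  have hz₀ : (F 0 - F 0) / (μ * P 0) = 0 := by rw [sub_self, zero_div]
  calc T ≤ ∫ y in Ioi ((F 0 - F 0) / (μ * P 0)), μ * (1 / √(|y| ^ 3 + 1)) := by
        refine lifespan_le_integral_Ioi (q := fun y => μ * (1 / √(|y| ^ 3 + 1)))
          (F := fun t => (F t - F 0) / (μ * P 0))
          (continuous_one_div_sqrt_abs_cube_add_one.const_mul μ)
          (fun y => by positivity)
          (integrable_one_div_sqrt_abs_cube_add_one.integrableOn.const_mul μ)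
          (fun t ht => ((hF t ht).sub_const (F 0)).div_const (μ * P 0)) fun t ht => ?_
        have h_lower :=
          mul_sqrt_rescaled_le_of_deriv_deriv_ge hμ hk.le h_scale hF hP hQ hF₀ hP₀ ht
        rw [mul_one_div, div_mul_div_comm, one_le_div (by positivity)]
        linarith [mul_le_mul_of_nonneg_left h_lower hμ.le]
    _ = μ * ∫ y in Ioi (0 : ℝ), 1 / √(y ^ 3 + 1) := by
        rw [hz₀, integral_const_mul]
        congr 1
        refine setIntegral_congr_fun measurableSet_Ioi fun y hy => ?_
        simp only [abs_of_pos (mem_Ioi.1 hy)]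

end Lifespan

/-! ### The moment `∫ (x - a) u²` along the flow -/

/-- The functional `p ↦ ∫_a^b (x - a) p(x) dx` on `H¹(ℝ)`, which applied to `u²` gives the quantity
whose convexity forces the blow-up. -/
noncomputable def H1.momentL (a b : ℝ) : H1 →L[ℝ] ℝ :=
  LinearMap.mkContinuous
    { toFun := fun p => ∫ x in a..b, (x - a) * p.rep x
      map_add' := fun p q => by
        have hp := p.continuous_rep
        have hq := q.continuous_rep
        rw [← intervalIntegral.integral_add (Continuous.intervalIntegrable (by fun_prop) _ _)
          (Continuous.intervalIntegrable (by fun_prop) _ _)]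
        simp only [H1.rep_add, Pi.add_apply, mul_add]
      map_smul' := fun c p => by
        simp only [H1.rep_smul, Pi.smul_apply, smul_eq_mul, RingHom.id_apply, mul_left_comm _ c,
          intervalIntegral.integral_const_mul] }
    (|b - a| * 2 * |b - a|) fun p => by
      have h_bound : ∀ x ∈ uIoc a b, ‖(x - a) * p.rep x‖ ≤ |b - a| * (2 * ‖p‖) := fun x hx => by
        rw [norm_mul]
        gcongr
        · exact abs_sub_left_of_mem_uIcc (uIoc_subset_uIcc hx)
        · exact p.abs_rep_le x
      refine (intervalIntegral.norm_integral_le_of_norm_le_const h_bound).trans_eq ?_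
      ring

theorem H1.momentL_apply (a b : ℝ) (p : H1) :
    H1.momentL a b p = ∫ x in a..b, (x - a) * p.rep x := rfl

theorem H1.momentL_sq_mul (a b : ℝ) (p q : H1) :
    H1.momentL a b (H1.mulL (H1.mulL p p) q) = ∫ x in a..b, (x - a) * p.fn x ^ 2 * q.fn x := by
  rw [H1.momentL_apply]
  refine intervalIntegral.integral_congr_ae ?_
  filter_upwards [p.rep_ae_eq, q.rep_ae_eq] with x hp hq _
  simp only [H1.rep_mulL, hp, hq]
  ring

theorem intervalIntegral_eq_integral_of_ae_eq_zero {a b : ℝ} (hab : a ≤ b) {f : ℝ → ℝ}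
    (hf : ∀ᵐ x, x ∉ Ioo a b → f x = 0) : ∫ x in a..b, f x = ∫ x, f x := by
  rw [intervalIntegral.integral_of_le hab]
  refine setIntegral_eq_integral_of_ae_compl_eq_zero ?_
  filter_upwards [hf] with x hx h_notMem
  exact hx (mt (Ioo_subset_Ioc_self ·) h_notMem)

section Moment

variable {a b : ℝ} {p : H1}

theorem H1.momentL_nonneg (hab : a ≤ b) (hp : ∀ x, 0 ≤ p.rep x) : 0 ≤ H1.momentL a b p :=
  intervalIntegral.integral_nonneg hab fun x hx => mul_nonneg (sub_nonneg.2 hx.1) (hp x)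

theorem H1.momentL_mul_self_nonneg (hab : a ≤ b) (p : H1) : 0 ≤ H1.momentL a b (H1.mulL p p) :=
  H1.momentL_nonneg hab fun x => by
    rw [H1.rep_mulL]
    exact mul_self_nonneg _

theorem H1.momentL_mul_self_le (hab : a ≤ b) (hp : ∀ᵐ x, x ∉ Ioo a b → p.rep x = 0) :
    H1.momentL a b (H1.mulL p p) ≤ (b - a) * ∫ x, p.rep x * p.rep x := by
  have h_cont := p.continuous_rep
  have h_integral : ∫ x in a..b, p.rep x * p.rep x = ∫ x, p.rep x * p.rep x := by
    refine intervalIntegral_eq_integral_of_ae_eq_zero hab ?_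
    filter_upwards [hp] with x hx h_notMem
    rw [hx h_notMem, zero_mul]
  rw [← h_integral, H1.momentL_apply, ← intervalIntegral.integral_const_mul]
  simp only [H1.rep_mulL]
  refine intervalIntegral.integral_mono_on hab (Continuous.intervalIntegrable (by fun_prop) _ _)
    (Continuous.intervalIntegrable (by fun_prop) _ _) fun x hx => ?_
  exact mul_le_mul_of_nonneg_right (by linarith [hx.2]) (mul_self_nonneg _)

theorem H1.momentL_hilb_eq (hab : a ≤ b) (hp : ∀ᵐ x, x ∉ Ioo a b → p.rep x = 0) :
    H1.momentL a b (H1.mulL (H1.mulL p p) (H1.hilbMulL p p)) =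
      (2 * Real.pi)⁻¹ * (∫ x, p.rep x * p.rep x) ^ 2 := by
  have h_cont := p.continuous_rep
  have h_moment : Integrable fun x => (x - a) * (p.rep x * p.rep x) := by
    refine (Continuous.continuousOn (by fun_prop)).integrableOn_Icc
      |>.integrable_of_ae_notMem_eq_zero (s := Icc a b) ?_
    filter_upwards [hp] with x hx h_notMem
    rw [hx (mt (Ioo_subset_Icc_self ·) h_notMem), mul_zero, mul_zero]
  rw [H1.momentL_apply, ← (p.isW1Pair_mul p).integral_sub_mul_mul_hilb h_moment]
  simp only [H1.rep_mulL, H1.rep_hilbMulL, ← mul_assoc]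
  refine intervalIntegral_eq_integral_of_ae_eq_zero hab ?_
  filter_upwards [hp] with x hx h_notMem
  rw [hx h_notMem, mul_zero, zero_mul]

theorem H1.sq_momentL_le_momentL_hilb (hab : a < b) (hp : ∀ᵐ x, x ∉ Ioo a b → p.rep x = 0) :
    2 / (Real.pi * (b - a) ^ 2) * H1.momentL a b (H1.mulL p p) ^ 2 ≤
      4 * H1.momentL a b (H1.mulL (H1.mulL p p) (H1.hilbMulL p p)) := by
  have hba : 0 < b - a := sub_pos.2 hab
  have h_nonneg := H1.momentL_mul_self_nonneg hab.le p
  calc 2 / (Real.pi * (b - a) ^ 2) * H1.momentL a b (H1.mulL p p) ^ 2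
      ≤ 2 / (Real.pi * (b - a) ^ 2) * ((b - a) * ∫ x, p.rep x * p.rep x) ^ 2 := by
        gcongr
        exact H1.momentL_mul_self_le hab.le hp
    _ = 4 * ((2 * Real.pi)⁻¹ * (∫ x, p.rep x * p.rep x) ^ 2) := by
        field_simp
        ring
    _ = 4 * H1.momentL a b (H1.mulL (H1.mulL p p) (H1.hilbMulL p p)) := by
        rw [H1.momentL_hilb_eq hab.le hp]

theorem H1.lt_of_momentL_sq_mul_pos (hp : ∀ᵐ x, x ∉ Ioo a b → p.rep x = 0) {q : H1}
    (h_pos : 0 < H1.momentL a b (H1.mulL (H1.mulL p p) q)) : a < b := by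
  by_contra! hba
  refine h_pos.ne' (intervalIntegral.integral_zero_ae ?_)
  filter_upwards [hp] with x hx _
  have h_zero : p.rep x = 0 := hx (Ioo_eq_empty hba.not_gt ▸ notMem_empty x)
  simp only [H1.rep_mulL, h_zero, zero_mul, mul_zero]

end Moment

section Blowup

variable {u₀ v₀ : H1} {T : ℝ} {w : ℝ → H1 × H1}

/-- Pointwise in `x` the first equation is the linear equation `u_t = (2v) u`. -/
theorem IsForwardSolution.rep_fst_eq_zero (h : IsForwardSolution modelField (u₀, v₀) T w) {x : ℝ}
    (hx : u₀.rep x = 0) {t : ℝ} (ht : t ∈ Ico 0 T) : (w t).1.rep x = 0 := by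
  obtain ⟨M, hM⟩ := h.exists_norm_le ht.2
  have h_deriv : ∀ s ∈ Ico 0 t, HasDerivWithinAt (fun s => (w s).1.rep x)
      (((2 : ℝ) • H1.mulL (w s).1 (w s).2).rep x) (Ici s) s := fun s hs =>
    (H1.evalL x).hasFDerivAt.comp_hasDerivWithinAt s
      (h.hasDerivWithinAt_Ici ⟨hs.1, hs.2.trans ht.2⟩).fst
  have h_cont : ContinuousOn (fun s => (w s).1.rep x) (Icc 0 t) :=
    (H1.evalL x).continuous.comp_continuousOn
      (h.continuousOn.mono (Icc_subset_Ico_right ht.2)).fst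
  have h_initial : (w 0).1.rep x = 0 := by rw [h.initial, hx]
  refine eq_zero_of_abs_deriv_le_mul_abs_self_of_eq_zero_right (K := 4 * M) h_cont h_deriv
    h_initial (fun s hs => ?_) t ⟨ht.1, le_rfl⟩
  have h_snd : ‖(w s).2.rep x‖ ≤ 2 * M := ((w s).2.abs_rep_le x).trans <| by
    linarith [(norm_snd_le (w s)).trans (hM s (Ico_subset_Icc_self hs))]
  calc ‖((2 : ℝ) • H1.mulL (w s).1 (w s).2).rep x‖
      = 2 * ‖(w s).1.rep x‖ * ‖(w s).2.rep x‖ := by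
        rw [H1.rep_two_smul_mulL, norm_mul, norm_mul, Real.norm_ofNat]
    _ ≤ 2 * ‖(w s).1.rep x‖ * (2 * M) := by gcongr
    _ = 4 * M * ‖(w s).1.rep x‖ := by ring

theorem IsForwardSolution.hasDerivWithinAt_sq (h : IsForwardSolution modelField (u₀, v₀) T w)
    {t : ℝ} (ht : t ∈ Ico 0 T) :
    HasDerivWithinAt (fun t => H1.mulL (w t).1 (w t).1)
      ((4 : ℝ) • H1.mulL (H1.mulL (w t).1 (w t).1) (w t).2) (Ico 0 T) t := by
  have h_fst : HasDerivWithinAt (fun t => (w t).1) ((2 : ℝ) • H1.mulL (w t).1 (w t).2)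
      (Ico 0 T) t := (h.hasDerivWithinAt t ht).fst
  convert! H1.mulL.hasDerivWithinAt_of_bilinear h_fst h_fst using 1
  refine H1.rep_injective (funext fun x => ?_)
  simp only [H1.rep_add, H1.rep_smul, Pi.add_apply, Pi.smul_apply, H1.rep_mulL, smul_eq_mul]
  ring

theorem IsForwardSolution.hasDerivWithinAt_sq_mul
    (h : IsForwardSolution modelField (u₀, v₀) T w) {t : ℝ} (ht : t ∈ Ico 0 T) :
    HasDerivWithinAt (fun t => H1.mulL (H1.mulL (w t).1 (w t).1) (w t).2)
      (H1.mulL (H1.mulL (w t).1 (w t).1) (H1.hilbMulL (w t).1 (w t).1) +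
        (4 : ℝ) • H1.mulL (H1.mulL (w t).1 (w t).2) (H1.mulL (w t).1 (w t).2)) (Ico 0 T) t := by
  have h_snd : HasDerivWithinAt (fun t => (w t).2) (H1.hilbMulL (w t).1 (w t).1) (Ico 0 T) t :=
    (h.hasDerivWithinAt t ht).snd
  convert! H1.mulL.hasDerivWithinAt_of_bilinear (h.hasDerivWithinAt_sq ht) h_snd using 2
  refine H1.rep_injective (funext fun x => ?_)
  simp only [H1.rep_smul, Pi.smul_apply, H1.rep_mulL, smul_eq_mul]
  ring

theorem IsForwardSolution.lifespan_le (h : IsForwardSolution modelField (u₀, v₀) T w) {a b : ℝ}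
    (h_supp : ∀ᵐ x, x ∉ Ioo a b → u₀.rep x = 0)
    (h_pos : 0 < H1.momentL a b (H1.mulL (H1.mulL u₀ u₀) v₀)) :
    T ≤ (4 * (4 * H1.momentL a b (H1.mulL (H1.mulL u₀ u₀) v₀)) /
        (3 * Real.pi * (b - a) ^ 2)) ^ (-(1 / 3) : ℝ) *
      ∫ y in Ioi (0 : ℝ), 1 / √(y ^ 3 + 1) := by
  have hab : a < b := H1.lt_of_momentL_sq_mul_pos h_supp h_pos
  have hba : 0 < b - a := sub_pos.2 hab
  have h_lifespan := lifespan_le_of_deriv_deriv_ge (T := T) (k := 2 / (Real.pi * (b - a) ^ 2))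
    (F := fun t => H1.momentL a b (H1.mulL (w t).1 (w t).1))
    (P := fun t => 4 * H1.momentL a b (H1.mulL (H1.mulL (w t).1 (w t).1) (w t).2))
    (Q := fun t => 4 * H1.momentL a b
      (H1.mulL (H1.mulL (w t).1 (w t).1) (H1.hilbMulL (w t).1 (w t).1) +
        (4 : ℝ) • H1.mulL (H1.mulL (w t).1 (w t).2) (H1.mulL (w t).1 (w t).2)))
    (by positivity)
    (fun t ht => by
      rw [← smul_eq_mul, ← map_smul]
      exact (H1.momentL a b).hasFDerivAt.comp_hasDerivWithinAt t (h.hasDerivWithinAt_sq ht))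
    (fun t ht => ((H1.momentL a b).hasFDerivAt.comp_hasDerivWithinAt t
      (h.hasDerivWithinAt_sq_mul ht)).const_mul 4)
    (fun t ht => by
      have h_supp_t : ∀ᵐ x, x ∉ Ioo a b → (w t).1.rep x = 0 :=
        h_supp.mono fun x hx h_notMem => h.rep_fst_eq_zero (hx h_notMem) ht
      rw [map_add, map_smul, smul_eq_mul]
      linarith [H1.sq_momentL_le_momentL_hilb hab h_supp_t,
        H1.momentL_mul_self_nonneg hab.le (H1.mulL (w t).1 (w t).2)])
    (H1.momentL_mul_self_nonneg hab.le _)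
    (by
      rw [h.initial]
      positivity)
  refine h_lifespan.trans_eq ?_
  rw [h.initial]
  congr 2
  field_simp
  ring

end Blowup

theorem mainTheorem1 (a b : ℝ) (u₀ v₀ : H1)
    (hsupp : ∀ᵐ x : ℝ, x ∉ Ioo a b → u₀.fn x = 0)
    (C : ℝ) (hC : C = 4 * ∫ x in a..b, (x - a) * u₀.fn x ^ 2 * v₀.fn x)
    (hCpos : 0 < C) :
    ∃ T : ℝ, 0 < T ∧
      T ≤ (4 * C / (3 * Real.pi * (b - a) ^ 2)) ^ (-(1 / 3) : ℝ)
          * ∫ y in Ioi (0 : ℝ), 1 / Real.sqrt (y ^ 3 + 1) ∧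
      ∃ u v : ℝ → H1, IsH1Solution u₀ v₀ T u v ∧
        Tendsto (fun t => ‖u t‖ + ‖v t‖) (𝓝[<] T) atTop ∧
        ∀ (T' : ℝ) (u' v' : ℝ → H1), IsH1Solution u₀ v₀ T' u' v' →
          T' ≤ T ∧ ∀ t ∈ Ico 0 T', u' t = u t ∧ v' t = v t := by
  have h_supp : ∀ᵐ x, x ∉ Ioo a b → u₀.rep x = 0 := by
    filter_upwards [hsupp, u₀.rep_ae_eq] with x hx h_rep h_notMem
    rw [h_rep, hx h_notMem]
  rw [← H1.momentL_sq_mul] at hC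
  have h_pos : 0 < H1.momentL a b (H1.mulL (H1.mulL u₀ u₀) v₀) := by linarith
  have h_lifespan : ∀ T w, IsForwardSolution modelField (u₀, v₀) T w → T ≤ _ :=
    fun T w h => h.lifespan_le h_supp h_pos
  rw [← hC] at h_lifespan
  obtain ⟨T, w, hw⟩ := lipschitzOnBalls_modelField.exists_isMaximalSolution
    ⟨_, fun T ⟨w, h⟩ => h_lifespan T w h⟩
  refine ⟨T, hw.pos, h_lifespan T w hw.toIsForwardSolution, fun t => (w t).1, fun t => (w t).2,
    hw.isH1Solution, ?_, fun T' u' v' h' => ?_⟩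
  · exact tendsto_atTop_mono (fun t => max_le_add_of_nonneg (norm_nonneg _) (norm_nonneg _))
      (hw.tendsto_norm_atTop lipschitzOnBalls_modelField)
  · exact ⟨hw.lifespan_le T' _ h'.isForwardSolution,
      fun t ht => Prod.ext_iff.1 (hw.eqOn T' _ h'.isForwardSolution ht)⟩
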